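/- Let $n\ge 1$, let $w:\mathbb R^n\to[0,\infty)$ and put $\Sigma=\{x: w(x)>0\}$. Suppose that, for some $\alpha\ge 0$, * $\Sigma$ is a nonempty open convex cone with vertex at the origin, $w\in C^2(\Sigma)$, and $w(tx)=t^{\alpha}w(x)$ for all $t>0$, $x\in\Sigma$; * $(\star)$: there is a constant $K>-1$ with $-\nabla^2(\log w)(x)\ge K\,\mathbb I$ for all $x\in\Sigma$. Let $K_w$ be the largest such constant. Let $A$ be the set of functions $u\in C_0^\infty(\overline\Sigma)$ (restrictions of compactly supported smooth functions on $\mathbb R^n$) with $\nabla u\cdot\eta=0$ on $\partial\Sigma$, where $\eta$ is the outer normal of $\Sigma$, and let $S_w$ be the completion of $A$ under the norm $\left(\int_\Sigma|\nabla u|^2w\,dx\right)^{1/2}+\left(\int_\Sigma|x|^2|u|^2w\,dx\right)^{1/2}$, whose elements are functions $f$ on $\Sigma$ together with their gradients $\nabla f$ (limits of $u_k$ and $\nabla u_k$ with $u_k\in A$). For $f\in S_w$ put $$\delta_w(f)=\left(\int_\Sigma|\nabla f|^2w\,dx\right)^{1/2}\left(\int_\Sigma|f|^2|x|^2w\,dx\right)^{1/2}-\frac{n+\alpha}{2}\int_\Sigma|f|^2w\,dx,$$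 $$E=\{ce^{-\beta|x|^2}:c\in\mathbb R,\ \beta>0\},\qquad d_w(f,E)=\inf_{c\in\mathbb R,\ \lambda\ne0}\left(\int_\Sigma\left|f-ce^{-\frac{|x|^2}{2\lambda^2}}\right|^2w\,dx\right)^{1/2}.$$ Then every $f\in S_w$ satisfies $\int_\Sigma|f|^2w\,dx<\infty$ and $$\delta_w(f)\ \ge\ (1+K_w)\,d_w(f,E)^2 .$$ Moreover, if $w$ is independent of the coordinate $x_i$ (that is, $w(x+te_i)=w(x)$ for all $x\in\mathbb R^n$, $t\in\mathbb R$), then the function $f(x)=x_ie^{-|x|^2/2}$ belongs to $S_w$, does not agree a.e. on $\Sigma$ with any element of $E$, and satisfies $\delta_w(f)=(1+K_w)\,d_w(f,E)^2$. -/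

import Mathlib

open MeasureTheory
open scoped ENNReal ContDiff

noncomputable section

namespace WeightedHeisenberg

/-- `ℝⁿ` with its Euclidean norm. -/
abbrev Rn (n : ℕ) : Type := EuclideanSpace ℝ (Fin n)

variable {n : ℕ}

/-- The positivity set `Σ = {x : w x > 0}`. -/
def supp (w : Rn n → ℝ) : Set (Rn n) := {x | 0 < w x}

/-- Homogeneous weights of degree `α`: `w ≥ 0`, the set `Σ` is a nonempty open convex cone with vertex
at the origin (closedness of `Σ` under positive dilations is contained in `homogeneous`), `w` is
twice continuously differentiable on `Σ`, and `w (t x) = t ^ α w x`. -/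
structure IsHomogeneousWeight (w : Rn n → ℝ) (α : ℝ) : Prop where
  nonneg : ∀ x, 0 ≤ w x
  nonempty : (supp w).Nonempty
  isOpen : IsOpen (supp w)
  convex : Convex ℝ (supp w)
  contDiffOn : ContDiffOn ℝ 2 w (supp w)
  homogeneous : ∀ t : ℝ, 0 < t → ∀ x ∈ supp w, w (t • x) = t ^ α * w x

/-- `-∇² (log w) ≥ K I` on `Σ`, as quadratic forms. -/
def HessianBound (w : Rn n → ℝ) (K : ℝ) : Prop :=
  ∀ x ∈ supp w, ∀ v : Rn n,
    K * ‖v‖ ^ 2 ≤ -(fderiv ℝ (fderiv ℝ (fun y => Real.log (w y))) x v v)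

/-- The condition `(⋆)`. -/
def Star (w : Rn n → ℝ) : Prop := ∃ K : ℝ, -1 < K ∧ HessianBound w K

/-- `K_w`, the largest `K` with `-∇² (log w) ≥ K I` on `Σ`. -/
def curvature (w : Rn n → ℝ) : ℝ := sSup {K : ℝ | HessianBound w K}

/-- The measure `w(x) dx`; it is carried by `Σ`, because `w` vanishes elsewhere. -/
def wMeasure (w : Rn n → ℝ) : Measure (Rn n) :=
  volume.withDensity (fun x => ENNReal.ofReal (w x))

/-- `η` is an outward normal vector at `x` to the convex set `S`. At boundary points where the normal
direction is unique, these are the nonnegative multiples of the outer unit normal. -/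
def IsOuterNormal (S : Set (Rn n)) (x η : Rn n) : Prop :=
  ∀ y ∈ S, inner ℝ η (y - x) ≤ 0

/-- The class `A`: compactly supported functions, smooth up to the boundary of `Σ`, whose normal
derivative vanishes on the boundary. At boundary points with several normal directions the condition
is asked for all of them; as `∇u` is continuous and `Σ` convex, this follows from the condition
at the points with a unique normal direction. -/
def TestClass (w : Rn n → ℝ) : Set (Rn n → ℝ) :=
  {u | ContDiff ℝ ∞ u ∧ HasCompactSupport u ∧
    ∀ x ∈ frontier (supp w), ∀ η, IsOuterNormal (supp w) x η → inner ℝ (gradient u x) η = 0}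

/-- `f` is an element of `S_w` and `g` is its gradient. Here `S_w`, the completion of `A` under the norm
`(∫ |∇u|² w)^{1/2} + (∫ |x|² |u|² w)^{1/2}`, is realized as the closure of `{(u, ∇u) : u ∈ A}` in
`L²(|x|² w dx) × L²(w dx; ℝⁿ)`. -/
structure MemS (w : Rn n → ℝ) (f : Rn n → ℝ) (g : Rn n → Rn n) : Prop where
  memLp_mul : MemLp (fun x => ‖x‖ * f x) 2 (wMeasure w)
  memLp_grad : MemLp g 2 (wMeasure w)
  approx : ∀ ε : ℝ≥0∞, 0 < ε → ∃ u ∈ TestClass w,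
    eLpNorm (fun x => gradient u x - g x) 2 (wMeasure w) +
      eLpNorm (fun x => ‖x‖ * (u x - f x)) 2 (wMeasure w) < ε

/-- The Heisenberg deficit `δ_w(f)`, where `g = ∇f`. -/
def deficit (w : Rn n → ℝ) (α : ℝ) (f : Rn n → ℝ) (g : Rn n → Rn n) : ℝ :=
  √(∫ x, ‖g x‖ ^ 2 ∂wMeasure w) * √(∫ x, |f x| ^ 2 * ‖x‖ ^ 2 ∂wMeasure w)
    - ((n : ℝ) + α) / 2 * ∫ x, |f x| ^ 2 ∂wMeasure w

/-- The set of Gaussians `c e^{-β |x|²}`, `c ∈ ℝ`, `β > 0`. -/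
def gaussians (n : ℕ) : Set (Rn n → ℝ) :=
  {h | ∃ c β : ℝ, 0 < β ∧ h = fun x => c * Real.exp (-β * ‖x‖ ^ 2)}

/-- The distance `d_w(f, E)` from `f` to the set of Gaussians in `L²(w dx)`: the infimum over
`c ∈ ℝ` and `l ≠ 0` of `(∫ |f - c e^{-|x|²/(2 l²)}|² w)^{1/2}`. -/
def gaussDist (w : Rn n → ℝ) (f : Rn n → ℝ) : ℝ :=
  ⨅ p : ℝ × {l : ℝ // l ≠ 0},
    √(∫ x, |f x - p.1 * Real.exp (-(‖x‖ ^ 2 / (2 * (p.2 : ℝ) ^ 2)))| ^ 2 ∂wMeasure w)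

/-- `w` does not depend on the `i`-th coordinate. -/
def IndependentOf (w : Rn n → ℝ) (i : Fin n) : Prop :=
  ∀ (x : Rn n) (t : ℝ), w (x + t • EuclideanSpace.single i (1 : ℝ)) = w x

/-- The function `x_i e^{-|x|²/2}`. -/
def hermite (i : Fin n) (x : Rn n) : ℝ := x i * Real.exp (-(‖x‖ ^ 2 / 2))

end WeightedHeisenberg

end

open MeasureTheory
open scoped ENNReal ContDiff

noncomputable section

namespace WeightedHeisenberg

/-! Homogeneity makes the Hessian of `log w` homogeneous of degree `-2`, so a bound by `K` at `t x`
is a bound by `K t²` at `x`. Letting `t → 0` gives the bound `0`, and letting `t → ∞` excludes `K >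
0`. Hence `K_w = 0`, the weight is log-concave, and the claim reduces to `δ_w(f) ≥ d_w(f, E)²`.

For log-concave `w` the measure `e^{-b|x|²} w dx` satisfies the Poincaré inequality with constant
`1/(2b)` (`exists_integral_sub_sq_le`). This follows from Prékopa–Leindler on all of `ℝⁿ`, where `w`
vanishes off the cone: if `F(x) + G(y) ≤ (b/2)|x - y|²`, then `∫ e^F ∫ e^G` is at most the squared
total mass. Taking `F = εv - ε² s |∇v|²` and `G = -εv` with `s > 1/(2b)`, and comparing terms of
order `ε²`, bounds the variance of `v`; then `s → 1/(2b)`.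

Apply this to `v = u e^{b|x|²/2}`. Expanding `|∇v|²` produces the cross term `∫ 2u ⟨∇u, x⟩ w`, which
Euler's identity for the homogeneous measure evaluates as `-(n + α) ∫ u² w`. The result
(`exists_integral_sub_gaussian_sq_le`) bounds the squared distance from `u` to a multiple of
`e^{-b|x|²/2}` by `(1/2b)∫|∇u|²w + (b/2)∫|x|²u²w - ((n+α)/2)∫u²w`. The bound passes to the closure
`S_w`, and optimizing over `b` turns the first two terms into the product of the norms, that is, the
right side into the deficit.

For equality, let `h = x_i e^{-|x|²/2}` with `w` independent of `x_i`. Integration by parts along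
`e_i` shows that `h` is orthogonal to every centred Gaussian, so its squared distance to `E` is `∫
h² w`. The same integration by parts and Euler's identity give all the moments in the deficit, which
also equals `∫ h² w`. -/

/-! ### The Prékopa–Leindler inequality for midpoints. -/

/-- One-dimensional Brunn–Minkowski inequality for compact sets. -/
lemma volume_add_le_of_isCompact {A B C : Set ℝ} (hA : IsCompact A) (hB : IsCompact B)
    (hA' : A.Nonempty) (hB' : B.Nonempty)
    (h : ∀ a ∈ A, ∀ b ∈ B, (a + b) / 2 ∈ C) : volume A + volume B ≤ 2 * volume C := by
  obtain ⟨a, haA, ha⟩ := hA.exists_isGreatest hA'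
  obtain ⟨b, hbB, hb⟩ := hB.exists_isLeast hB'
  have h2 : volume ((fun x : ℝ => (1 / 2 : ℝ) * x) ⁻¹' C) = 2 * volume C := by
    rw [Real.volume_preimage_mul_left (by norm_num)]
    norm_num
  rw [← h2]
  -- With `a = max A` and `b = min B`, the translates `A + b` and `B + a` lie in `2C` and meet at
  -- most at the point `a + b`.
  have hA2 : volume ((fun x => x + (-b)) ⁻¹' A) = volume A := measure_preimage_add_right _ _ _
  have hB2 : volume ((fun x => x + (-a)) ⁻¹' B) = volume B := measure_preimage_add_right _ _ _
  rw [← hA2, ← hB2, ← measure_union₀']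
  · apply measure_mono
    rintro x (hx | hx)
    · have := h _ hx _ hbB
      simp only [Set.mem_preimage] at *
      convert this using 1
      ring
    · have := h _ haA _ hx
      simp only [Set.mem_preimage] at *
      convert this using 1
      ring
  · exact (measurable_add_const _ hA.measurableSet).nullMeasurableSet
  · refine measure_mono_null (t := {a + b}) ?_ (by simp)
    rintro x ⟨hx, hx'⟩
    have h1 := ha hx
    have h2 := hb hx'
    simp only [Set.mem_singleton_iff]
    linarith

/-- One-dimensional Brunn–Minkowski inequality. -/
lemma volume_add_le_of_measurableSet {A B C : Set ℝ} (hA : MeasurableSet A) (hB : MeasurableSet B)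
    (hA' : A.Nonempty) (hB' : B.Nonempty)
    (h : ∀ a ∈ A, ∀ b ∈ B, (a + b) / 2 ∈ C) : volume A + volume B ≤ 2 * volume C := by
  obtain ⟨a, ha⟩ := hA'
  obtain ⟨b, hb⟩ := hB'
  have key : ∀ K ⊆ A, IsCompact K → ∀ L ⊆ B, IsCompact L → volume K + volume L ≤ 2 * volume C := by
    intro K hK hKc L hL hLc
    -- Adding the fixed points `a` and `b` makes the inner approximations nonempty, as the compact
    -- case requires.
    have := volume_add_le_of_isCompact (C := C) (hKc.insert a) (hLc.insert b)
      (Set.insert_nonempty _ _) (Set.insert_nonempty _ _)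
      (fun x hx y hy => h x (Set.insert_subset ha hK hx) y (Set.insert_subset hb hL hy))
    refine le_trans ?_ this
    gcongr <;> exact Set.subset_insert _ _
  rw [hA.measure_eq_iSup_isCompact, hB.measure_eq_iSup_isCompact]
  have hn : Nonempty {K : Set ℝ // K ⊆ A ∧ IsCompact K} := ⟨∅, by simp⟩
  have hn' : Nonempty {K : Set ℝ // K ⊆ B ∧ IsCompact K} := ⟨∅, by simp⟩
  have e1 : (⨆ K, ⨆ (_ : K ⊆ A), ⨆ (_ : IsCompact K), volume K)
      = ⨆ K : {K : Set ℝ // K ⊆ A ∧ IsCompact K}, volume K.1 := by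
    simp only [iSup_subtype, iSup_and]
  have e2 : (⨆ K, ⨆ (_ : K ⊆ B), ⨆ (_ : IsCompact K), volume K)
      = ⨆ K : {K : Set ℝ // K ⊆ B ∧ IsCompact K}, volume K.1 := by
    simp only [iSup_subtype, iSup_and]
  rw [e1, e2]
  simp only [ENNReal.iSup_add, ENNReal.add_iSup, iSup_le_iff]
  intro L K
  exact key _ K.2.1 K.2.2 _ L.2.1 L.2.2

/-- The arithmetic–geometric mean inequality, which turns the additive Brunn–Minkowski bound into
the multiplicative Prékopa–Leindler form. -/
lemma ennreal_mul_le_sq_of_add_le {a b c : ℝ≥0∞} (h : a + b ≤ 2 * c) : a * b ≤ c ^ 2 := by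
  rcases eq_or_ne c ⊤ with rfl | hc
  · simp
  have ht : a + b ≠ ⊤ := ne_top_of_le_ne_top (ENNReal.mul_ne_top (by simp) hc) h
  rw [ENNReal.add_ne_top] at ht
  lift a to NNReal using ht.1
  lift b to NNReal using ht.2
  lift c to NNReal using hc
  norm_cast at h ⊢
  rw [← NNReal.coe_le_coe] at h ⊢
  push_cast at h ⊢
  nlinarith [sq_nonneg ((a : ℝ) - b), a.2, b.2, c.2, sq_nonneg ((a:ℝ) + b)]

lemma lintegral_eq_lintegral_meas_of_le_one {f : ℝ → ℝ≥0∞} (hf : Measurable f) (h1 : ∀ x, f x ≤ 1) :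
    ∫⁻ x, f x = ∫⁻ t in Set.Ioo (0 : ℝ) 1, volume {x | ENNReal.ofReal t < f x} := by
  have h2 : ∀ x, f x ≠ ⊤ := fun x => ne_top_of_le_ne_top (by simp) (h1 x)
  have h3 : ∫⁻ x, f x = ∫⁻ x, ENNReal.ofReal ((f x).toReal) := by
    simp only [ENNReal.ofReal_toReal (h2 _)]
  rw [h3, lintegral_eq_lintegral_meas_lt _ (by filter_upwards; intro x; simp)
    hf.ennreal_toReal.aemeasurable]
  have h4 : Set.Ioi (0 : ℝ) = Set.Ioo 0 1 ∪ Set.Ici 1 := (Set.Ioo_union_Ici_eq_Ioi (by norm_num)).symm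
  rw [h4, lintegral_union measurableSet_Ici (by
    rw [Set.disjoint_left]; rintro x hx hx'; exact absurd hx.2 (not_lt.2 hx'))]
  have h5 : ∫⁻ t in Set.Ici (1 : ℝ), volume {a | t < (f a).toReal} = 0 := by
    rw [setLIntegral_congr_fun (g := fun _ => 0) measurableSet_Ici]
    · simp
    intro t ht
    have : {a | t < (f a).toReal} = ∅ := by
      ext a
      simp only [Set.mem_ofPred_eq, Set.mem_empty_iff_false, iff_false, not_lt]
      refine le_trans ?_ (Set.mem_Ici.1 ht)
      simpa using ENNReal.toReal_mono (by simp) (h1 a)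
    simp [this]
  rw [h5, add_zero]
  apply setLIntegral_congr_fun measurableSet_Ioo
  intro t ht
  simp only
  congr 1
  ext x
  simp only [Set.mem_ofPred_eq]
  rw [ENNReal.ofReal_lt_iff_lt_toReal ht.1.le (h2 x)]

/-- The midpoints of the superlevel sets of `f` and `g` at height `t` lie in that of `h`. With both
suprema equal to `1`, the first two sets are nonempty for every `t < 1`, so Brunn–Minkowski applies
at each height, and the layer-cake formula integrates the result. -/
lemma prekopaLeindler_real_of_iSup_eq_one {f g h : ℝ → ℝ≥0∞} (hf : Measurable f) (hg : Measurable g)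
    (hh : Measurable h) (hf1 : ⨆ x, f x = 1) (hg1 : ⨆ x, g x = 1)
    (hfg : ∀ x y, f x * g y ≤ h ((x + y) / 2) ^ 2) :
    (∫⁻ x, f x) * (∫⁻ x, g x) ≤ (∫⁻ x, h x) ^ 2 := by
  have hf1' : ∀ x, f x ≤ 1 := fun x => hf1 ▸ le_iSup f x
  have hg1' : ∀ x, g x ≤ 1 := fun x => hg1 ▸ le_iSup g x
  -- Truncation at `1` keeps the hypothesis, because `f g ≤ 1`, and confines the layer-cake integral
  -- of `h'` to heights in `(0, 1)`.
  set h' : ℝ → ℝ≥0∞ := fun x => min (h x) 1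
  have hh' : Measurable h' := hh.min measurable_const
  have hfg' : ∀ x y, f x * g y ≤ h' ((x + y) / 2) ^ 2 := by
    intro x y
    rcases le_total (h ((x + y) / 2)) 1 with h0 | h0
    · simpa [h', h0] using hfg x y
    · simpa [h', h0] using mul_le_mul' (hf1' x) (hg1' y)
  have hle : ∫⁻ x, h' x ≤ ∫⁻ x, h x := lintegral_mono fun x => min_le_left _ _
  refine le_trans (ennreal_mul_le_sq_of_add_le ?_) (pow_le_pow_left' hle 2)
  rw [lintegral_eq_lintegral_meas_of_le_one hf hf1', lintegral_eq_lintegral_meas_of_le_one hg hg1',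
    lintegral_eq_lintegral_meas_of_le_one hh' (fun x => min_le_right _ _)]
  have hanti : Antitone fun t : ℝ => volume {x | ENNReal.ofReal t < f x} := by
    intro s t hst
    exact measure_mono fun x hx => lt_of_le_of_lt (ENNReal.ofReal_le_ofReal hst) hx
  rw [← lintegral_add_left hanti.measurable, ← lintegral_const_mul' _ _ (by simp)]
  refine setLIntegral_mono' measurableSet_Ioo fun t ht => ?_
  have ht1 : ENNReal.ofReal t < 1 := by
    rw [← ENNReal.ofReal_one]; exact (ENNReal.ofReal_lt_ofReal_iff (by norm_num)).2 ht.2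
  refine volume_add_le_of_measurableSet (measurableSet_lt measurable_const hf)
    (measurableSet_lt measurable_const hg) ?_ ?_ ?_
  · exact lt_iSup_iff.1 (hf1.symm ▸ ht1)
  · exact lt_iSup_iff.1 (hg1.symm ▸ ht1)
  · intro a ha b hb
    simp only [Set.mem_ofPred_eq] at ha hb ⊢
    by_contra hcon
    have h1 : f a * g b ≤ ENNReal.ofReal t ^ 2 := (hfg' a b).trans (pow_le_pow_left' (not_lt.1 hcon) 2)
    have h2 := ENNReal.mul_lt_mul ha hb
    rw [sq] at h1
    exact absurd h1 (not_le.2 h2)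

lemma prekopaLeindler_real_of_iSup_ne_top {f g h : ℝ → ℝ≥0∞} (hf : Measurable f) (hg : Measurable g)
    (hh : Measurable h) (hf1 : ⨆ x, f x ≠ ⊤) (hg1 : ⨆ x, g x ≠ ⊤)
    (hfg : ∀ x y, f x * g y ≤ h ((x + y) / 2) ^ 2) :
    (∫⁻ x, f x) * (∫⁻ x, g x) ≤ (∫⁻ x, h x) ^ 2 := by
  set a := ⨆ x, f x with ha
  set b := ⨆ x, g x with hb
  rcases eq_or_ne a 0 with h0 | ha0
  · have : ∀ x, f x = 0 := fun x => by simpa [ha.symm, h0] using le_iSup f x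
    simp [this]
  rcases eq_or_ne b 0 with h0 | hb0
  · have : ∀ x, g x = 0 := fun x => by simpa [hb.symm, h0] using le_iSup g x
    simp [this]
  -- The hypothesis survives division of `f`, `g`, `h` by `a`, `b` and the geometric mean `c =
  -- √(ab)`.
  obtain ⟨c, hc⟩ : ∃ c : ℝ≥0∞, c ^ 2 = a * b :=
    ⟨(a * b) ^ (1 / 2 : ℝ), by rw [← ENNReal.rpow_natCast, ← ENNReal.rpow_mul]; norm_num⟩
  have hc0 : c ≠ 0 := by rintro rfl; simp at hc; rcases hc with h | h <;> contradiction
  have hct : c ≠ ⊤ := by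
    rintro rfl
    exact ENNReal.mul_ne_top hf1 hg1 (by simpa using hc.symm)
  have hcinv : (c⁻¹) ^ 2 = a⁻¹ * b⁻¹ := by
    rw [← ENNReal.inv_pow, hc, ENNReal.mul_inv (Or.inl ha0) (Or.inl hf1)]
  have key := prekopaLeindler_real_of_iSup_eq_one (f := fun x => a⁻¹ * f x) (g := fun x => b⁻¹ * g x)
    (h := fun x => c⁻¹ * h x) (hf.const_mul _) (hg.const_mul _) (hh.const_mul _)
    (by rw [← ENNReal.mul_iSup, ENNReal.inv_mul_cancel ha0 hf1])
    (by rw [← ENNReal.mul_iSup, ENNReal.inv_mul_cancel hb0 hg1])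
    (fun x y => by
      rw [mul_pow, hcinv, mul_mul_mul_comm]
      gcongr
      exact hfg x y)
  rw [lintegral_const_mul _ hf, lintegral_const_mul _ hg, lintegral_const_mul _ hh, mul_pow, hcinv,
    mul_mul_mul_comm, ← hcinv] at key
  have hcc : c ^ 2 * (c⁻¹) ^ 2 = 1 := by rw [← mul_pow, ENNReal.mul_inv_cancel hc0 hct, one_pow]
  have := mul_le_mul_right key (c ^ 2)
  rwa [← mul_assoc, hcc, one_mul, ← mul_assoc, hcc, one_mul] at this

/-- The Prékopa–Leindler inequality on the real line, for midpoints. -/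
lemma prekopaLeindler_real {f g h : ℝ → ℝ≥0∞} (hf : Measurable f) (hg : Measurable g)
    (hh : Measurable h) (hfg : ∀ x y, f x * g y ≤ h ((x + y) / 2) ^ 2) :
    (∫⁻ x, f x) * (∫⁻ x, g x) ≤ (∫⁻ x, h x) ^ 2 := by
  have trunc : ∀ {f : ℝ → ℝ≥0∞}, Measurable f → ∫⁻ x, f x = ⨆ k : ℕ, ∫⁻ x, min (f x) k := by
    intro f hf
    rw [← lintegral_iSup (fun k => hf.min measurable_const)]
    · congr 1 with x
      rw [← inf_iSup_eq, ENNReal.iSup_natCast, inf_top_eq]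
    · intro i j hij x
      exact min_le_min_left _ (by exact_mod_cast hij)
  rw [trunc hf, trunc hg]
  simp only [ENNReal.iSup_mul, ENNReal.mul_iSup, iSup_le_iff]
  intro k j
  refine prekopaLeindler_real_of_iSup_ne_top (hf.min measurable_const) (hg.min measurable_const) hh
    ?_ ?_ ?_
  · exact ne_top_of_le_ne_top (ENNReal.natCast_ne_top _) (iSup_le fun x => min_le_right _ _)
  · exact ne_top_of_le_ne_top (ENNReal.natCast_ne_top _) (iSup_le fun x => min_le_right _ _)
  · exact fun x y => (mul_le_mul' (min_le_left _ _) (min_le_left _ _)).trans (hfg x y)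

/-- The Prékopa–Leindler inequality on `ℝⁿ`, for midpoints. -/
lemma prekopaLeindler_pi (n : ℕ) : ∀ {f g h : (Fin n → ℝ) → ℝ≥0∞}, Measurable f → Measurable g →
    Measurable h → (∀ x y, f x * g y ≤ h ((1 / 2 : ℝ) • (x + y)) ^ 2) →
    (∫⁻ x, f x) * (∫⁻ x, g x) ≤ (∫⁻ x, h x) ^ 2 := by
  induction n with
  | zero =>
    intro f g h _ _ _ hfg
    rw [Measure.volume_pi_eq_dirac 0, lintegral_dirac, lintegral_dirac, lintegral_dirac]
    convert hfg 0 0 using 3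
  | succ n ih =>
    intro f g h hf hg hh hfg
    set e := (MeasurableEquiv.piFinSuccAbove (fun _ : Fin (n + 1) => ℝ) 0).symm
    have he := (volume_preserving_piFinSuccAbove (fun _ : Fin (n + 1) => ℝ) 0).symm
    have slice : ∀ {f : (Fin (n + 1) → ℝ) → ℝ≥0∞}, Measurable f →
        ∫⁻ x, f x = ∫⁻ s, ∫⁻ x, f (e (s, x)) := by
      intro f hf
      rw [← he.lintegral_comp hf, Measure.volume_eq_prod]
      exact lintegral_prod _ (hf.comp e.measurable).aemeasurable
    have meas : ∀ {f : (Fin (n + 1) → ℝ) → ℝ≥0∞}, Measurable f →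
        Measurable fun s : ℝ => ∫⁻ x, f (e (s, x)) :=
      fun hf => (hf.comp e.measurable).lintegral_prod_right'
    rw [slice hf, slice hg, slice hh]
    -- The integrals over slices satisfy the one-dimensional hypothesis: for fixed `s` and `t` it is
    -- the `n`-dimensional inequality applied to the slices at `s`, `t` and `(s + t)/2`.
    refine prekopaLeindler_real (meas hf) (meas hg) (meas hh) fun s t => ?_
    refine ih (hf.comp (e.measurable.comp measurable_prodMk_left))
      (hg.comp (e.measurable.comp measurable_prodMk_left))
      (hh.comp (e.measurable.comp measurable_prodMk_left)) fun x y => ?_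
    refine (hfg _ _).trans (le_of_eq ?_)
    congr 2
    ext i
    refine Fin.cases ?_ (fun j => ?_) i
    · simp [e]; ring
    · simp [e]; ring

lemma prekopaLeindler {n : ℕ} {f g h : Rn n → ℝ≥0∞} (hf : Measurable f) (hg : Measurable g)
    (hh : Measurable h) (hfg : ∀ x y, f x * g y ≤ h ((1 / 2 : ℝ) • (x + y)) ^ 2) :
    (∫⁻ x, f x) * (∫⁻ x, g x) ≤ (∫⁻ x, h x) ^ 2 := by
  have he := PiLp.volume_preserving_toLp (Fin n)
  rw [← he.lintegral_comp hf, ← he.lintegral_comp hg, ← he.lintegral_comp hh]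
  refine prekopaLeindler_pi n (hf.comp he.measurable) (hg.comp he.measurable)
    (hh.comp he.measurable) fun x y => ?_
  exact hfg _ _

/-! ### The Poincaré inequality for a Gaussian times a log-concave weight. -/

open Filter Topology

/-- The measure `e^{-b|x|²} w(x) dx`. -/
def gaussMeasure {n : ℕ} (w : Rn n → ℝ) (b : ℝ) : Measure (Rn n) :=
  (wMeasure w).withDensity fun x => ENNReal.ofReal (Real.exp (-(b * ‖x‖ ^ 2)))

lemma lintegral_gaussMeasure {n : ℕ} {w : Rn n → ℝ} (hw : Measurable w) (b : ℝ)
    {F : Rn n → ℝ≥0∞} (hF : Measurable F) : ∫⁻ x, F x ∂gaussMeasure w b =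
      ∫⁻ x, ENNReal.ofReal (w x) * (ENNReal.ofReal (Real.exp (-(b * ‖x‖ ^ 2))) * F x) := by
  have hm : Measurable fun x : Rn n => ENNReal.ofReal (Real.exp (-(b * ‖x‖ ^ 2))) := by fun_prop
  rw [gaussMeasure, lintegral_withDensity_eq_lintegral_mul _ hm hF, wMeasure,
    lintegral_withDensity_eq_lintegral_mul _ (by fun_prop) (hm.mul hF)]
  rfl

/-- Prékopa–Leindler with the Gaussian density times `w` as the third function. By the parallelogram
law, the midpoint gains exactly `(b/2)|x - y|²` in the Gaussian exponent, which pays for `F(x) +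
G(y)`. -/
lemma lintegral_exp_mul_lintegral_exp_le {n : ℕ} {w : Rn n → ℝ} (hw : Measurable w)
    (hw0 : ∀ x, 0 ≤ w x) (hmid : ∀ x y, w x * w y ≤ w ((1 / 2 : ℝ) • (x + y)) ^ 2) (b : ℝ)
    {F G : Rn n → ℝ} (hF : Measurable F) (hG : Measurable G)
    (hFG : ∀ x y, F x + G y ≤ b / 2 * ‖x - y‖ ^ 2) :
    (∫⁻ x, ENNReal.ofReal (Real.exp (F x)) ∂gaussMeasure w b) *
      (∫⁻ x, ENNReal.ofReal (Real.exp (G x)) ∂gaussMeasure w b) ≤ gaussMeasure w b Set.univ ^ 2 := by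
  rw [← lintegral_one (μ := gaussMeasure w b), lintegral_gaussMeasure hw b (by fun_prop),
    lintegral_gaussMeasure hw b (by fun_prop), lintegral_gaussMeasure hw b (by fun_prop)]
  refine prekopaLeindler (by fun_prop) (by fun_prop) (by fun_prop) fun x y => ?_
  simp only [mul_one]
  rw [← ENNReal.ofReal_mul (Real.exp_nonneg _), ← ENNReal.ofReal_mul (hw0 _),
    ← ENNReal.ofReal_mul (Real.exp_nonneg _), ← ENNReal.ofReal_mul (hw0 _),
    ← ENNReal.ofReal_mul (hw0 _), ← ENNReal.ofReal_mul
      (mul_nonneg (hw0 _) (mul_nonneg (Real.exp_nonneg _) (Real.exp_nonneg _))),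
    ← ENNReal.ofReal_pow (mul_nonneg (hw0 _) (Real.exp_nonneg _))]
  apply ENNReal.ofReal_le_ofReal
  have hpar : ‖x‖ ^ 2 + ‖y‖ ^ 2 - 2 * ‖(1 / 2 : ℝ) • (x + y)‖ ^ 2 = ‖x - y‖ ^ 2 / 2 := by
    have h := parallelogram_law_with_norm ℝ x y
    rw [norm_smul, mul_pow]
    norm_num
    nlinarith
  rw [← Real.exp_add, ← Real.exp_add]
  calc w x * Real.exp (-(b * ‖x‖ ^ 2) + F x) * (w y * Real.exp (-(b * ‖y‖ ^ 2) + G y))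
      = (w x * w y) * Real.exp (-(b * ‖x‖ ^ 2) + F x + (-(b * ‖y‖ ^ 2) + G y)) := by
        rw [Real.exp_add (_ + _)]; ring
    _ ≤ w ((1 / 2 : ℝ) • (x + y)) ^ 2 * Real.exp (2 * (-(b * ‖(1 / 2 : ℝ) • (x + y)‖ ^ 2))) := by
        refine mul_le_mul (hmid x y) (Real.exp_le_exp.2 ?_) (Real.exp_nonneg _) (sq_nonneg _)
        have := hFG x y
        have h2 : b * (‖x‖ ^ 2 + ‖y‖ ^ 2 - 2 * ‖(1 / 2 : ℝ) • (x + y)‖ ^ 2)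
          = b * (‖x - y‖ ^ 2 / 2) := by rw [hpar]
        linarith
    _ = _ := by rw [mul_pow, two_mul, Real.exp_add]; ring

lemma integral_exp_mul_integral_exp_le {n : ℕ} {w : Rn n → ℝ} (hw : Measurable w)
    (hw0 : ∀ x, 0 ≤ w x) (hmid : ∀ x y, w x * w y ≤ w ((1 / 2 : ℝ) • (x + y)) ^ 2) (b : ℝ)
    [IsFiniteMeasure (gaussMeasure w b)]
    {F G : Rn n → ℝ} (hF : Measurable F) (hG : Measurable G)
    (hFG : ∀ x y, F x + G y ≤ b / 2 * ‖x - y‖ ^ 2) :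
    (∫ x, Real.exp (F x) ∂gaussMeasure w b) * (∫ x, Real.exp (G x) ∂gaussMeasure w b)
      ≤ (gaussMeasure w b).real Set.univ ^ 2 := by
  rw [integral_eq_lintegral_of_nonneg_ae (by filter_upwards; intro x; positivity)
      (by fun_prop), integral_eq_lintegral_of_nonneg_ae (by filter_upwards; intro x; positivity)
      (by fun_prop), ← ENNReal.toReal_mul, Measure.real, ← ENNReal.toReal_pow]
  exact ENNReal.toReal_mono (by finiteness)
    (lintegral_exp_mul_lintegral_exp_le hw hw0 hmid b hF hG hFG)

lemma quadratic_sub_cubic_le_exp {t : ℝ} (ht : |t| ≤ 1) :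
    1 + t + t ^ 2 / 2 - |t| ^ 3 ≤ Real.exp t := by
  have h := Real.exp_bound ht (n := 3) (by norm_num)
  norm_num [Finset.sum_range_succ, Nat.factorial] at h
  have h1 := (abs_le.1 h).1
  have h2 : 0 ≤ |t| ^ 3 := by positivity
  linarith

/-- A lower Taylor bound to order `e²` with a cubic error uniform in the point. The condition `e (M
+ s M) ≤ 1` keeps the exponent in `[-1, 1]`; the cross term of the square is absorbed in `e³ s M²`,
and the fourth-order term is dropped by its sign. -/
lemma le_exp_of_abs_le {v q M s e : ℝ} (hv : |v| ≤ M) (hq : 0 ≤ q) (hqM : q ≤ M) (hs : 0 ≤ s)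
    (he : 0 ≤ e) (he1 : e ≤ 1) (heM : e * (M + s * M) ≤ 1) :
    1 + e * v + e ^ 2 * (v ^ 2 / 2 - s * q) - e ^ 3 * ((M + s * M) ^ 3 + s * M ^ 2) ≤
      Real.exp (e * v - e ^ 2 * s * q) := by
  have hM : 0 ≤ M := hq.trans hqM
  have hsq : s * q ≤ s * M := mul_le_mul_of_nonneg_left hqM hs
  have hsq0 : 0 ≤ s * q := mul_nonneg hs hq
  have ht : |e * v - e ^ 2 * s * q| ≤ e * (M + s * M) := by
    calc |e * v - e ^ 2 * s * q| ≤ |e * v| + |e ^ 2 * s * q| := abs_sub _ _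
      _ = e * |v| + e * (e * (s * q)) := by
        rw [abs_mul, abs_of_nonneg he, mul_assoc (e ^ 2), abs_of_nonneg (mul_nonneg (sq_nonneg e) hsq0)]
        ring
      _ ≤ e * M + e * (1 * (s * M)) := by gcongr
      _ = _ := by ring
  have h1 := quadratic_sub_cubic_le_exp (ht.trans heM)
  have h2 : |e * v - e ^ 2 * s * q| ^ 3 ≤ (e * (M + s * M)) ^ 3 :=
    pow_le_pow_left₀ (abs_nonneg _) ht 3
  have h3 : v * (s * q) ≤ s * M ^ 2 := by
    calc v * (s * q) ≤ M * (s * M) :=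
          mul_le_mul ((le_abs_self v).trans hv) hsq hsq0 hM
      _ = _ := by ring
  have h4 : e ^ 3 * (v * (s * q)) ≤ e ^ 3 * (s * M ^ 2) := by gcongr
  have h5 : 0 ≤ (e ^ 2 * s * q) ^ 2 := sq_nonneg _
  nlinarith

/-- A second order expansion turns an exponential inequality into a Poincaré inequality. -/
lemma variance_le_of_integral_exp_le {X : Type*} [MeasurableSpace X] {ν : Measure X}
    [IsFiniteMeasure ν] {v q : X → ℝ} (hv : Measurable v) (hq : Measurable q) {M s e₀ : ℝ}
    (hvM : ∀ x, |v x| ≤ M) (hq0 : ∀ x, 0 ≤ q x) (hqM : ∀ x, q x ≤ M) (hs : 0 ≤ s) (he₀ : 0 < e₀)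
    (h : ∀ e, 0 < e → e < e₀ →
      (∫ x, Real.exp (e * v x - e ^ 2 * s * q x) ∂ν) * (∫ x, Real.exp (e * -v x - e ^ 2 * 0 * q x) ∂ν)
        ≤ ν.real Set.univ ^ 2) (hZ : 0 < ν.real Set.univ) :
    ν.real Set.univ * ∫ x, v x ^ 2 ∂ν - (∫ x, v x ∂ν) ^ 2 ≤
      s * (ν.real Set.univ * ∫ x, q x ∂ν) := by
  set Z := ν.real Set.univ
  have iv : Integrable v ν := Integrable.of_bound hv.aestronglyMeasurable M (by
    filter_upwards; intro x; simpa using hvM x)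
  have iv2 : Integrable (fun x => v x ^ 2) ν := Integrable.of_bound
    (hv.pow_const 2).aestronglyMeasurable (M ^ 2) (by
      filter_upwards; intro x
      rw [norm_pow]; exact pow_le_pow_left₀ (norm_nonneg _) (hvM x) 2)
  have iq : Integrable q ν := Integrable.of_bound hq.aestronglyMeasurable M (by
    filter_upwards; intro x; rw [Real.norm_eq_abs, abs_of_nonneg (hq0 x)]; exact hqM x)
  set m := ∫ x, v x ∂ν
  set m2 := ∫ x, v x ^ 2 ∂ν
  set Q := ∫ x, q x ∂ν
  -- lower bound for the exponential integrals
  have low : ∀ (σ s : ℝ), σ ^ 2 = 1 → 0 ≤ s → ∀ e, 0 ≤ e → e ≤ 1 → e * (M + s * M) ≤ 1 →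
      Z + e * (σ * m) + e ^ 2 * (m2 / 2 - s * Q) - e ^ 3 * ((M + s * M) ^ 3 + s * M ^ 2) * Z ≤
      ∫ x, Real.exp (e * (σ * v x) - e ^ 2 * s * q x) ∂ν := by
    intro σ s hσ hs e he he1 heM
    have hσv : ∀ x, |σ * v x| ≤ M := by
      intro x
      rw [abs_mul, (pow_eq_one_iff_of_nonneg (abs_nonneg σ) two_ne_zero).1 (by rw [sq_abs, hσ]),
        one_mul]
      exact hvM x
    have hint : ∫ x, (1 + e * (σ * v x) + e ^ 2 * (v x ^ 2 / 2 - s * q x)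
        - e ^ 3 * ((M + s * M) ^ 3 + s * M ^ 2)) ∂ν
        = Z + e * (σ * m) + e ^ 2 * (m2 / 2 - s * Q) - e ^ 3 * ((M + s * M) ^ 3 + s * M ^ 2) * Z := by
      rw [integral_sub (by fun_prop) (by fun_prop), integral_add (by fun_prop) (by fun_prop),
        integral_add (by fun_prop) (by fun_prop), integral_const_mul, integral_const_mul,
        integral_const_mul, integral_sub (by fun_prop) (by fun_prop), integral_const_mul,
        integral_div, integral_const, integral_const]
      simp only [smul_eq_mul, mul_one]
      ring
    rw [← hint]
    refine integral_mono (by fun_prop) ?_ ?_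
    · refine Integrable.of_bound (by fun_prop) (Real.exp 1) ?_
      filter_upwards
      intro x
      rw [Real.norm_eq_abs, Real.abs_exp]
      apply Real.exp_le_exp.2
      have h1 : e * (σ * v x) ≤ e * M := mul_le_mul_of_nonneg_left ((le_abs_self _).trans (hσv x)) he
      have h2 : 0 ≤ e ^ 2 * s * q x := mul_nonneg (by positivity) (hq0 x)
      have h3 : 0 ≤ e * (s * M) := mul_nonneg he (mul_nonneg hs ((hq0 x).trans (hqM x)))
      linarith
    · intro x
      have := le_exp_of_abs_le (hσv x) (hq0 x) (hqM x) hs he he1 heM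
      have h2 : (σ * v x) ^ 2 = v x ^ 2 := by rw [mul_pow, hσ, one_mul]
      rw [h2] at this
      exact this
  set C := (M + s * M) ^ 3 + s * M ^ 2
  set C' := (M + 0 * M) ^ 3 + 0 * M ^ 2
  set A : ℝ → ℝ := fun e => m2 / 2 - s * Q - e * C * Z
  set B : ℝ → ℝ := fun e => m2 / 2 - 0 * Q - e * C' * Z
  -- Chosen so that the product of the two lower bounds is `Z² + e² p(e)`. Thus `p(e) ≤ 0` for small
  -- `e > 0`, and `p(0) ≤ 0` is the claim.
  set p : ℝ → ℝ := fun e => Z * A e + Z * B e - m ^ 2 + e * m * (B e - A e) + e ^ 2 * (A e * B e)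
  have ev : ∀ c : ℝ, ∀ᶠ e in 𝓝[>] (0 : ℝ), e * c < 1 := by
    intro c
    have : Tendsto (fun e : ℝ => e * c) (𝓝[>] 0) (𝓝 (0 * c)) :=
      ((continuous_id.mul continuous_const).tendsto 0).mono_left nhdsWithin_le_nhds
    rw [zero_mul] at this
    exact this.eventually_lt_const one_pos
  have hpos : ∀ᶠ e in 𝓝[>] (0 : ℝ), 0 < Z - e * m + e ^ 2 * B e := by
    have : Tendsto (fun e : ℝ => Z - e * m + e ^ 2 * B e) (𝓝[>] 0)
        (𝓝 (Z - 0 * m + 0 ^ 2 * B 0)) := by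
      refine (Continuous.tendsto ?_ 0).mono_left nhdsWithin_le_nhds
      fun_prop
    exact this.eventually_const_lt (by simpa using hZ)
  have hp : ∀ᶠ e in 𝓝[>] (0 : ℝ), p e ≤ 0 := by
    filter_upwards [ev 1, ev (M + s * M), ev (M + 0 * M), hpos, self_mem_nhdsWithin,
      (eventually_lt_nhds he₀).filter_mono nhdsWithin_le_nhds] with e h1 h2 h3 h4 h5 h6
    have he : (0 : ℝ) < e := h5
    have l1 := low 1 s (by norm_num) hs e he.le (by linarith) h2.le
    have l2 := low (-1) 0 (by norm_num) le_rfl e he.le (by linarith) h3.le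
    have l3 := h e he h6
    simp only [one_mul, neg_one_mul] at l1 l2
    have l4 : (Z + e * m + e ^ 2 * A e) * (Z - e * m + e ^ 2 * B e) ≤ Z ^ 2 := by
      refine le_trans (mul_le_mul ?_ ?_ h4.le (by positivity)) l3
      · refine le_trans (le_of_eq ?_) l1
        simp only [A, C]; ring
      · refine le_trans (le_of_eq ?_) l2
        simp only [B, C']; ring
    have l5 : e ^ 2 * p e ≤ 0 := by
      have : (Z + e * m + e ^ 2 * A e) * (Z - e * m + e ^ 2 * B e) = Z ^ 2 + e ^ 2 * p e := by
        simp only [p]; ring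
      linarith
    by_contra hcon
    exact absurd l5 (not_le.2 (mul_pos (by positivity) (not_le.1 hcon)))
  have hlim : Tendsto p (𝓝[>] 0) (𝓝 (p 0)) := by
    refine (Continuous.tendsto ?_ 0).mono_left nhdsWithin_le_nhds
    fun_prop
  have := le_of_tendsto hlim hp
  simp only [p, A, B] at this
  linarith

/-- The Poincaré inequality for `e^{-b|x|²} w(x) dx` with `w` log-concave. -/
lemma exists_integral_sub_sq_le {n : ℕ} {w : Rn n → ℝ} (hw : Measurable w)
    (hw0 : ∀ x, 0 ≤ w x) (hmid : ∀ x y, w x * w y ≤ w ((1 / 2 : ℝ) • (x + y)) ^ 2) {b : ℝ}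
    (hb : 0 < b) [IsFiniteMeasure (gaussMeasure w b)] (hZ : 0 < (gaussMeasure w b).real Set.univ)
    {v : Rn n → ℝ} {G : Rn n → Rn n} (hv : Measurable v) (hG : Measurable G) {M L : ℝ}
    (hvM : ∀ x, |v x| ≤ M) (hGM : ∀ x, ‖G x‖ ^ 2 ≤ M)
    (hvG : ∀ x y, v x - v y ≤ inner ℝ (G x) (x - y) + L * ‖x - y‖ ^ 2) :
    ∃ c : ℝ, ∫ x, (v x - c) ^ 2 ∂gaussMeasure w b ≤
      1 / (2 * b) * ∫ x, ‖G x‖ ^ 2 ∂gaussMeasure w b := by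
  set ν := gaussMeasure w b
  set Z := ν.real Set.univ
  -- For `s > 1/(2b)` the gap `b/2 - 1/(4s)` is positive and absorbs the second-order error `e L |x
  -- - y|²` once `e` is small. The sharp constant appears as `s → 1/(2b)`.
  have step : ∀ s, 1 / (2 * b) < s →
      Z * ∫ x, v x ^ 2 ∂ν - (∫ x, v x ∂ν) ^ 2 ≤ s * (Z * ∫ x, ‖G x‖ ^ 2 ∂ν) := by
    intro s hs
    have hs0 : 0 < s := lt_trans (by positivity) hs
    have hgap : 0 < b / 2 - 1 / (4 * s) := by
      rw [div_lt_iff₀ (by positivity)] at hs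
      rw [sub_pos, div_lt_iff₀ (by positivity)]
      linarith
    refine variance_le_of_integral_exp_le (M := M) (e₀ := (b / 2 - 1 / (4 * s)) / (|L| + 1)) hv
      (by fun_prop) hvM (fun x => by positivity) hGM hs0.le (by positivity) ?_ hZ
    intro e he he'
    refine integral_exp_mul_integral_exp_le hw hw0 hmid b (by fun_prop) (by fun_prop) fun x y => ?_
    rw [lt_div_iff₀ (by positivity)] at he'
    have h1 := mul_le_mul_of_nonneg_left (hvG x y) he.le
    have h2 : e * L * ‖x - y‖ ^ 2 ≤ (b / 2 - 1 / (4 * s)) * ‖x - y‖ ^ 2 := by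
      gcongr
      nlinarith [le_abs_self L]
    have h3 : inner ℝ (G x) (x - y) ≤ ‖G x‖ * ‖x - y‖ := real_inner_le_norm _ _
    -- Young's inequality: the penalty `e² s |G|²` leaves only `|x - y|²/(4s)`.
    have h4 : e * (‖G x‖ * ‖x - y‖) ≤ e ^ 2 * s * ‖G x‖ ^ 2 + 1 / (4 * s) * ‖x - y‖ ^ 2 := by
      have := sq_nonneg (e * ‖G x‖ * (2 * s) - ‖x - y‖)
      have h5 : e ^ 2 * s * ‖G x‖ ^ 2 + 1 / (4 * s) * ‖x - y‖ ^ 2 - e * (‖G x‖ * ‖x - y‖)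
        = 1 / (4 * s) * (e * ‖G x‖ * (2 * s) - ‖x - y‖) ^ 2 := by
        field_simp; ring
      have h6 : 0 ≤ 1 / (4 * s) * (e * ‖G x‖ * (2 * s) - ‖x - y‖) ^ 2 := by positivity
      linarith
    have h5 := mul_le_mul_of_nonneg_left h3 he.le
    linarith
  have main : Z * ∫ x, v x ^ 2 ∂ν - (∫ x, v x ∂ν) ^ 2 ≤
      1 / (2 * b) * (Z * ∫ x, ‖G x‖ ^ 2 ∂ν) := by
    refine ge_of_tendsto (x := 𝓝[>] (1 / (2 * b))) (f := fun s => s * (Z * ∫ x, ‖G x‖ ^ 2 ∂ν)) ?_ ?_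
    · exact ((continuous_id.mul continuous_const).tendsto _).mono_left nhdsWithin_le_nhds
    · filter_upwards [self_mem_nhdsWithin] with s hs using step s hs
  have iv : Integrable v ν := Integrable.of_bound hv.aestronglyMeasurable M (by
    filter_upwards; intro x; simpa using hvM x)
  have iv2 : Integrable (fun x => v x ^ 2) ν := Integrable.of_bound
    (hv.pow_const 2).aestronglyMeasurable (M ^ 2) (by
      filter_upwards; intro x
      rw [norm_pow]; exact pow_le_pow_left₀ (norm_nonneg _) (hvM x) 2)
  -- The constant is the mean of `v`.
  refine ⟨(∫ x, v x ∂ν) / Z, ?_⟩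
  set m := ∫ x, v x ∂ν
  have hint : ∫ x, (v x - m / Z) ^ 2 ∂ν = ∫ x, v x ^ 2 ∂ν - m ^ 2 / Z := by
    have : ∀ x, (v x - m / Z) ^ 2 = v x ^ 2 - 2 * (m / Z) * v x + (m / Z) ^ 2 := fun x => by ring
    simp only [this]
    rw [integral_add (by fun_prop) (by fun_prop), integral_sub (by fun_prop) (by fun_prop),
      integral_const_mul, integral_const]
    simp only [smul_eq_mul]
    change _ - 2 * (m / Z) * m + Z * (m / Z) ^ 2 = _
    field_simp
    ring
  rw [hint]
  refine le_of_mul_le_mul_left ?_ hZ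
  calc Z * (∫ x, v x ^ 2 ∂ν - m ^ 2 / Z) = Z * ∫ x, v x ^ 2 ∂ν - m ^ 2 := by field_simp
    _ ≤ _ := main
    _ = _ := by ring

/-- Taylor's formula with the Lipschitz constant of the derivative. The expansion is at `x` because
the penalty `|∇v|²` in the Prékopa–Leindler argument is evaluated at the same point. -/
lemma exists_forall_sub_le_of_hasCompactSupport {n : ℕ} {v : Rn n → ℝ} (hv : ContDiff ℝ 2 v)
    (hs : HasCompactSupport v) : ∃ L : ℝ, ∀ x y,
      v x - v y ≤ inner ℝ (gradient v x) (x - y) + L * ‖x - y‖ ^ 2 := by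
  have h1 : ContDiff ℝ 1 (fderiv ℝ v) := hv.fderiv_right (by norm_num)
  obtain ⟨L, hL⟩ := h1.lipschitzWith_of_hasCompactSupport (hs.fderiv (𝕜 := ℝ)) (by norm_num)
  refine ⟨L, fun x y => ?_⟩
  have h2 : ‖v y - v x - fderiv ℝ v x (y - x)‖ ≤ L * ‖y - x‖ * ‖y - x‖ := by
    refine (convex_segment x y).norm_image_sub_le_of_norm_fderiv_le' (𝕜 := ℝ)
      (fun z _ => (hv.differentiable (by norm_num)).differentiableAt) (fun z hz => ?_)
      (left_mem_segment ℝ x y) (right_mem_segment ℝ x y)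
    refine (hL.norm_sub_le z x).trans ?_
    gcongr
    exact norm_sub_le_of_mem_segment hz
  have h3 : inner ℝ (gradient v x) (x - y) = -fderiv ℝ v x (y - x) := by
    rw [gradient, InnerProductSpace.toDual_symm_apply, ← map_neg, neg_sub]
  rw [h3, norm_sub_rev x y]
  have h4 := (abs_le.1 h2).1
  nlinarith

/-! ### Homogeneous weights: curvature, log-concavity and integrability. -/

section Weight

variable {n : ℕ} {w : Rn n → ℝ} {α : ℝ}

lemma IsHomogeneousWeight.smul_mem (hw : IsHomogeneousWeight w α) {t : ℝ} (ht : 0 < t) {x : Rn n}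
    (hx : x ∈ supp w) : t • x ∈ supp w := by
  change 0 < w (t • x)
  rw [hw.homogeneous t ht x hx]
  exact mul_pos (Real.rpow_pos_of_pos ht _) hx

lemma IsHomogeneousWeight.apply_smul (hw : IsHomogeneousWeight w α) {t : ℝ} (ht : 0 < t)
    (x : Rn n) : w (t • x) = t ^ α * w x := by
  by_cases hx : x ∈ supp w
  · exact hw.homogeneous t ht x hx
  have h0 : ∀ y, y ∉ supp w → w y = 0 := fun y hy => le_antisymm (not_lt.1 hy) (hw.nonneg y)
  have hx' : t • x ∉ supp w := fun h => hx (by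
    have := hw.smul_mem (inv_pos.2 ht) h
    rwa [smul_smul, inv_mul_cancel₀ ht.ne', one_smul] at this)
  rw [h0 _ hx, h0 _ hx', mul_zero]

lemma IsHomogeneousWeight.measurable (hw : IsHomogeneousWeight w α) : Measurable w := by
  classical
  have : w = (supp w).piecewise w 0 := by
    ext x
    by_cases hx : x ∈ supp w
    · simp [hx]
    · simpa [hx] using le_antisymm (not_lt.1 hx) (hw.nonneg x)
  rw [this]
  exact ContinuousOn.measurable_piecewise hw.contDiffOn.continuousOn
    continuous_zero.continuousOn hw.isOpen.measurableSet

lemma IsHomogeneousWeight.contDiffAt_log (hw : IsHomogeneousWeight w α) {x : Rn n}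
    (hx : x ∈ supp w) : ContDiffAt ℝ 2 (fun y => Real.log (w y)) x :=
  (hw.contDiffOn.contDiffAt (hw.isOpen.mem_nhds hx)).log (ne_of_gt hx)

lemma IsHomogeneousWeight.fderiv_log_smul (hw : IsHomogeneousWeight w α) {t : ℝ} (ht : 0 < t)
    {x : Rn n} (hx : x ∈ supp w) : t • fderiv ℝ (fun y => Real.log (w y)) (t • x) =
      fderiv ℝ (fun y => Real.log (w y)) x := by
  rw [← fderiv_comp_smul (f := fun y => Real.log (w y))]
  have : (fun y => Real.log (w (t • y))) =ᶠ[𝓝 x] fun y => Real.log (t ^ α) + Real.log (w y) := by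
    filter_upwards [hw.isOpen.mem_nhds hx] with y hy
    rw [hw.homogeneous t ht y hy, Real.log_mul (Real.rpow_pos_of_pos ht _).ne' (ne_of_gt hy)]
  rw [this.fderiv_eq, fderiv_const_add]

lemma IsHomogeneousWeight.fderiv_fderiv_log_smul (hw : IsHomogeneousWeight w α) {t : ℝ}
    (ht : 0 < t) {x : Rn n} (hx : x ∈ supp w) (v : Rn n) :
    t ^ 2 * fderiv ℝ (fderiv ℝ (fun y => Real.log (w y))) (t • x) v v =
      fderiv ℝ (fderiv ℝ (fun y => Real.log (w y))) x v v := by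
  set D := fderiv ℝ (fun y => Real.log (w y))
  have h1 : (fun y => t • D (t • y)) =ᶠ[𝓝 x] D := by
    filter_upwards [hw.isOpen.mem_nhds hx] with y hy using hw.fderiv_log_smul ht hy
  have hd : DifferentiableAt ℝ (fun y => D (t • y)) x := by
    have h2 : DifferentiableAt ℝ D (t • x) :=
      ((hw.contDiffAt_log (hw.smul_mem ht hx)).fderiv_right (m := 1)
        (by norm_num)).differentiableAt (by norm_num)
    have h3 : DifferentiableAt ℝ (fun y : Rn n => t • y) x := by fun_prop
    exact DifferentiableAt.comp x h2 h3
  have h2 : fderiv ℝ (fun y => t • D (t • y)) x = fderiv ℝ D x := h1.fderiv_eq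
  rw [fderiv_fun_const_smul hd, fderiv_comp_smul] at h2
  rw [← h2]
  simp only [smul_apply, smul_eq_mul]
  ring

/-- The Hessian bound read at `t x` and pulled back to `x`: homogeneity makes every `K t²` as good a
constant as `K`. -/
lemma IsHomogeneousWeight.mul_sq_le_of_hessianBound (hw : IsHomogeneousWeight w α) {K : ℝ}
    (hK : HessianBound w K) {x : Rn n} (hx : x ∈ supp w) (v : Rn n) {t : ℝ} (ht : 0 < t) :
    K * t ^ 2 * ‖v‖ ^ 2 ≤ -(fderiv ℝ (fderiv ℝ (fun y => Real.log (w y))) x v v) := by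
  have := mul_le_mul_of_nonneg_left (hK _ (hw.smul_mem ht hx) v) (sq_nonneg t)
  rw [← hw.fderiv_fderiv_log_smul ht hx]
  linarith

lemma IsHomogeneousWeight.hessianBound_zero (hw : IsHomogeneousWeight w α) (h : Star w) :
    HessianBound w 0 := by
  obtain ⟨K, -, hK⟩ := h
  intro x hx v
  rw [zero_mul]
  refine le_of_tendsto (x := 𝓝[>] (0 : ℝ)) (f := fun t => K * t ^ 2 * ‖v‖ ^ 2) ?_ ?_
  · have : Tendsto (fun t : ℝ => K * t ^ 2 * ‖v‖ ^ 2) (𝓝 0) (𝓝 (K * 0 ^ 2 * ‖v‖ ^ 2)) :=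
      Continuous.tendsto (by fun_prop) 0
    simp only [ne_eq, OfNat.ofNat_ne_zero, not_false_eq_true, zero_pow, mul_zero, zero_mul] at this
    exact this.mono_left nhdsWithin_le_nhds
  · filter_upwards [self_mem_nhdsWithin] with t ht using hw.mul_sq_le_of_hessianBound hK hx v ht

lemma IsHomogeneousWeight.nonpos_of_hessianBound (hw : IsHomogeneousWeight w α) (hn : 1 ≤ n)
    {K : ℝ} (hK : HessianBound w K) : K ≤ 0 := by
  by_contra! hpos
  obtain ⟨x, hx⟩ := hw.nonempty
  -- With a unit vector, `K t² ≤ c` would hold for all `t > 0`. The choice `t = |c|/K + 1` satisfies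
  -- `t ≥ 1` and `K t > |c|`, a contradiction.
  set v : Rn n := EuclideanSpace.single ⟨0, hn⟩ 1
  set c := -(fderiv ℝ (fderiv ℝ (fun y => Real.log (w y))) x v v)
  have h1 := hw.mul_sq_le_of_hessianBound hK hx v (t := |c| / K + 1) (by positivity)
  have hv : ‖v‖ = 1 := by simp [v]
  rw [hv] at h1
  have h2 : |c| < K * (|c| / K + 1) := by
    rw [mul_add, mul_div_cancel₀ _ hpos.ne']; linarith
  have h3 : (1 : ℝ) ≤ |c| / K + 1 := by
    have : 0 ≤ |c| / K := by positivity
    linarith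
  have h4 : c ≤ |c| := le_abs_self c
  have h5 : K * (|c| / K + 1) ≤ K * (|c| / K + 1) ^ 2 :=
    mul_le_mul_of_nonneg_left (le_self_pow₀ h3 two_ne_zero) hpos.le
  simp only [one_pow, mul_one] at h1
  change _ ≤ c at h1
  linarith

/-- Homogeneity forces `K_w = 0`. -/
lemma IsHomogeneousWeight.curvature_eq_zero (hw : IsHomogeneousWeight w α) (h : Star w)
    (hn : 1 ≤ n) : curvature w = 0 :=
  IsGreatest.csSup_eq ⟨hw.hessianBound_zero h, fun _ hK => hw.nonpos_of_hessianBound hn hK⟩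

lemma IsHomogeneousWeight.hasDerivAt_log_lineMap (hw : IsHomogeneousWeight w α) {x d : Rn n} {s : ℝ}
    (hs : x + s • d ∈ supp w) : HasDerivAt (fun s : ℝ => Real.log (w (x + s • d)))
      (fderiv ℝ (fun y => Real.log (w y)) (x + s • d) d) s := by
  have h1 : HasDerivAt (fun s : ℝ => x + s • d) d s := by
    simpa using ((hasDerivAt_id s).smul_const d).const_add x
  exact ((hw.contDiffAt_log hs).differentiableAt (by norm_num)).hasFDerivAt.comp_hasDerivAt s h1

lemma IsHomogeneousWeight.hasDerivAt_fderiv_log_lineMap (hw : IsHomogeneousWeight w α) {x d : Rn n}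
    {s : ℝ} (hs : x + s • d ∈ supp w) :
    HasDerivAt (fun s : ℝ => fderiv ℝ (fun y => Real.log (w y)) (x + s • d) d)
      (fderiv ℝ (fderiv ℝ (fun y => Real.log (w y))) (x + s • d) d d) s := by
  have h1 : HasDerivAt (fun s : ℝ => x + s • d) d s := by
    simpa using ((hasDerivAt_id s).smul_const d).const_add x
  have h2 := (((hw.contDiffAt_log hs).fderiv_right (m := 1) (by norm_num)).differentiableAt
    (by norm_num)).hasFDerivAt.comp_hasDerivAt s h1
  simpa using h2.clm_apply (hasDerivAt_const s d)

lemma IsHomogeneousWeight.add_smul_sub_mem (hw : IsHomogeneousWeight w α) {x y : Rn n}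
    (hx : x ∈ supp w) (hy : y ∈ supp w) {s : ℝ} (hs : s ∈ Set.Icc (0 : ℝ) 1) :
    x + s • (y - x) ∈ supp w :=
  hw.convex.add_smul_sub_mem hx hy hs

lemma IsHomogeneousWeight.concaveOn_log_segment (hw : IsHomogeneousWeight w α)
    (h : HessianBound w 0) {x y : Rn n} (hx : x ∈ supp w) (hy : y ∈ supp w) :
    ConcaveOn ℝ (Set.Icc (0 : ℝ) 1) (fun s : ℝ => Real.log (w (x + s • (y - x)))) := by
  have hmem : ∀ s ∈ interior (Set.Icc (0 : ℝ) 1), x + s • (y - x) ∈ supp w :=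
    fun s hs => hw.add_smul_sub_mem hx hy (interior_subset hs)
  refine concaveOn_of_hasDerivWithinAt2_nonpos (convex_Icc 0 1)
    (fun s hs => (hw.hasDerivAt_log_lineMap
      (hw.add_smul_sub_mem hx hy hs)).continuousAt.continuousWithinAt)
    (fun s hs => (hw.hasDerivAt_log_lineMap (hmem s hs)).hasDerivWithinAt)
    (fun s hs => (hw.hasDerivAt_fderiv_log_lineMap (hmem s hs)).hasDerivWithinAt) fun s hs => ?_
  have := h _ (hmem s hs) (y - x)
  linarith

/-- Log-concavity of `w` on all of `ℝⁿ`, in the form used by Prékopa–Leindler. Off the cone the left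
side vanishes. -/
lemma IsHomogeneousWeight.mul_le_midpoint_sq (hw : IsHomogeneousWeight w α)
    (h : HessianBound w 0) (x y : Rn n) : w x * w y ≤ w ((1 / 2 : ℝ) • (x + y)) ^ 2 := by
  by_cases hx : x ∈ supp w
  swap
  · rw [le_antisymm (not_lt.1 hx) (hw.nonneg x), zero_mul]; positivity
  by_cases hy : y ∈ supp w
  swap
  · rw [le_antisymm (not_lt.1 hy) (hw.nonneg y), mul_zero]; positivity
  have hm : (1 / 2 : ℝ) • (x + y) ∈ supp w := by
    have := hw.add_smul_sub_mem hx hy (s := 1 / 2) (by norm_num)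
    convert this using 1
    module
  have h1 := (hw.concaveOn_log_segment h hx hy).2 (Set.left_mem_Icc.2 zero_le_one)
    (Set.right_mem_Icc.2 zero_le_one) (show (0 : ℝ) ≤ 1 / 2 by norm_num)
    (show (0 : ℝ) ≤ 1 / 2 by norm_num) (by norm_num)
  have e1 : x + ((1 / 2 : ℝ) • (0 : ℝ) + (1 / 2 : ℝ) • (1 : ℝ)) • (y - x)
      = (1 / 2 : ℝ) • (x + y) := by
    simp only [smul_eq_mul, mul_zero, mul_one, zero_add]; module
  simp only [e1] at h1
  simp only [zero_smul, add_zero, one_smul, add_sub_cancel, smul_eq_mul] at h1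
  have hx0 : 0 < w x := hx
  have hy0 : 0 < w y := hy
  have hm0 : 0 < w ((1 / 2 : ℝ) • (x + y)) := hm
  rw [← Real.log_le_log_iff (mul_pos hx0 hy0) (by positivity), Real.log_mul hx0.ne' hy0.ne',
    Real.log_pow]
  push_cast
  linarith

/-- A concave function lies below its tangent at any point, so `log w` grows at most linearly. This
makes every Gaussian integrable against `w`. -/
lemma IsHomogeneousWeight.exists_le_exp (hw : IsHomogeneousWeight w α) (h : HessianBound w 0) :
    ∃ A B : ℝ, 0 ≤ B ∧ ∀ x, w x ≤ Real.exp (A + B * ‖x‖) := by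
  obtain ⟨x, hx⟩ := hw.nonempty
  set D := fderiv ℝ (fun y => Real.log (w y)) x
  refine ⟨Real.log (w x) + ‖D‖ * ‖x‖, ‖D‖, norm_nonneg _, fun y => ?_⟩
  by_cases hy : y ∈ supp w
  swap
  · rw [le_antisymm (not_lt.1 hy) (hw.nonneg y)]; positivity
  have hd := hw.hasDerivAt_log_lineMap (x := x) (d := y - x) (s := 0) (by simpa using hx)
  have h1 := (hw.concaveOn_log_segment h hx hy).slope_le_of_hasDerivAt (x := 0) (y := 1)
    (by norm_num) (by norm_num) (by norm_num) hd
  simp only [slope_def_field, one_smul, add_sub_cancel, zero_smul, add_zero, sub_zero, div_one]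
    at h1
  have h2 : D (y - x) ≤ ‖D‖ * (‖y‖ + ‖x‖) := by
    refine (le_abs_self _).trans ((D.le_opNorm _).trans ?_)
    gcongr
    exact norm_sub_le _ _
  rw [← Real.log_le_iff_le_exp hy]
  change _ ≤ D (y - x) at h1
  linarith

lemma integrable_exp_neg_mul_sq_norm {c : ℝ} (hc : 0 < c) :
    Integrable fun x : Rn n => Real.exp (-(c * ‖x‖ ^ 2)) := by
  have h := (GaussianFourier.integrable_cexp_neg_mul_sq_norm_add (V := Rn n) (b := (c : ℂ))
    (by simpa using hc) 0 0).norm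
  refine h.congr ?_
  filter_upwards
  intro x
  rw [Complex.norm_exp]
  norm_cast
  simp

lemma integrable_wMeasure_iff (hw : Measurable w) (hw0 : ∀ x, 0 ≤ w x) {F : Rn n → ℝ} :
    Integrable F (wMeasure w) ↔ Integrable fun x => w x * F x := by
  have h := integrable_withDensity_iff_integrable_smul (μ := (volume : Measure (Rn n)))
    (f := fun x => (w x).toNNReal) (g := F) (by fun_prop)
  refine h.trans (iff_of_eq (congrArg (fun f => Integrable f volume) ?_))
  ext x
  rw [NNReal.smul_def, Real.coe_toNNReal _ (hw0 x), smul_eq_mul]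

lemma integral_wMeasure (hw : Measurable w) (hw0 : ∀ x, 0 ≤ w x) (F : Rn n → ℝ) :
    ∫ x, F x ∂wMeasure w = ∫ x, w x * F x := by
  have h := integral_withDensity_eq_integral_smul (μ := (volume : Measure (Rn n)))
    (f := fun x => (w x).toNNReal) (by fun_prop) F
  refine h.trans (integral_congr_ae ?_)
  filter_upwards
  intro x
  rw [NNReal.smul_def, Real.coe_toNNReal _ (hw0 x), smul_eq_mul]

lemma IsHomogeneousWeight.integrable_exp (hw : IsHomogeneousWeight w α) (h : HessianBound w 0)
    {c : ℝ} (hc : 0 < c) : Integrable (fun x => Real.exp (-(c * ‖x‖ ^ 2))) (wMeasure w) := by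
  obtain ⟨A, B, hB, hAB⟩ := hw.exists_le_exp h
  have hm := hw.measurable
  rw [integrable_wMeasure_iff hw.measurable hw.nonneg]
  refine ((integrable_exp_neg_mul_sq_norm (n := n) (half_pos hc)).const_mul
    (Real.exp (A + B ^ 2 / (2 * c)))).mono' (by fun_prop) ?_
  filter_upwards
  intro x
  rw [Real.norm_of_nonneg (mul_nonneg (hw.nonneg x) (Real.exp_nonneg _)), ← Real.exp_add]
  refine (mul_le_mul_of_nonneg_right (hAB x) (Real.exp_nonneg _)).trans ?_
  rw [← Real.exp_add]
  apply Real.exp_le_exp.2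
  -- Completing the square: half of the Gaussian decay absorbs the linear growth of `log w`.
  have h1 : B ^ 2 / (2 * c) - B * ‖x‖ + c / 2 * ‖x‖ ^ 2 = (B - c * ‖x‖) ^ 2 / (2 * c) := by
    field_simp; ring
  have h2 : 0 ≤ (B - c * ‖x‖) ^ 2 / (2 * c) := by positivity
  linarith

lemma IsHomogeneousWeight.integrable_of_le_exp (hw : IsHomogeneousWeight w α)
    (h : HessianBound w 0) {E : Type*} [NormedAddCommGroup E] {F : Rn n → E}
    (hF : AEStronglyMeasurable F (wMeasure w)) {c C : ℝ} (hc : 0 < c)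
    (hFC : ∀ x, ‖F x‖ ≤ C * Real.exp (-(c * ‖x‖ ^ 2))) : Integrable F (wMeasure w) :=
  ((hw.integrable_exp h hc).const_mul C).mono' hF (by filter_upwards; exact hFC)

lemma exists_le_exp_of_hasCompactSupport {F : Rn n → ℝ} (hF : Continuous F)
    (hs : HasCompactSupport F) : ∃ C : ℝ, ∀ x, ‖F x‖ ≤ C * Real.exp (-(1 * ‖x‖ ^ 2)) := by
  have h1 : Continuous fun x => Real.exp (‖x‖ ^ 2) * F x := by fun_prop
  obtain ⟨C, hC⟩ := h1.bounded_above_of_compact_support (hs.mul_left)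
  refine ⟨C, fun x => ?_⟩
  have := hC x
  rw [norm_mul, Real.norm_of_nonneg (Real.exp_nonneg _)] at this
  rw [one_mul, Real.exp_neg, ← div_eq_mul_inv, le_div_iff₀ (Real.exp_pos _)]
  linarith

lemma IsHomogeneousWeight.integrable_of_hasCompactSupport (hw : IsHomogeneousWeight w α)
    (h : HessianBound w 0) {F : Rn n → ℝ} (hF : Continuous F) (hs : HasCompactSupport F) :
    Integrable F (wMeasure w) := by
  obtain ⟨C, hC⟩ := exists_le_exp_of_hasCompactSupport hF hs
  exact hw.integrable_of_le_exp h (by fun_prop) one_pos hC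

lemma IsHomogeneousWeight.wMeasure_ne_zero (hw : IsHomogeneousWeight w α) :
    wMeasure w ≠ 0 := by
  intro h
  have h1 : volume (supp w) = 0 := by
    have h2 := (withDensity_apply_eq_zero (μ := (volume : Measure (Rn n)))
      (f := fun x => ENNReal.ofReal (w x)) (s := Set.univ)
      (by have := hw.measurable; fun_prop)).1 (by
        change wMeasure w Set.univ = 0
        simp [h])
    convert h2 using 2
    ext x
    simp [supp]
  exact (hw.isOpen.measure_pos volume hw.nonempty).ne' h1

end Weight

/-! ### Euler's identity and the stability estimate at a fixed scale. -/

section Euler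

variable {n : ℕ} {w : Rn n → ℝ} {α : ℝ}

lemma IsHomogeneousWeight.integral_comp_smul (hw : IsHomogeneousWeight w α) (F : Rn n → ℝ) {t : ℝ}
    (ht : 0 < t) : ∫ x, F (t • x) ∂wMeasure w = t ^ (-((n : ℝ) + α)) * ∫ x, F x ∂wMeasure w := by
  rw [integral_wMeasure hw.measurable hw.nonneg, integral_wMeasure hw.measurable hw.nonneg]
  have h1 : ∀ x, w x * F (t • x) = t ^ (-α) * (w (t • x) * F (t • x)) := by
    intro x
    have : t ^ (-α) * t ^ α = 1 := by rw [← Real.rpow_add ht, neg_add_cancel, Real.rpow_zero]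
    simp only [hw.apply_smul ht x]
    linear_combination (-(w x * F (t • x))) * this
  simp only [h1]
  have h2 : ∫ x, w (t • x) * F (t • x) = |(t ^ Module.finrank ℝ (Rn n))⁻¹| • ∫ x, w x * F x :=
    Measure.integral_comp_smul volume (fun y => w y * F y) t
  rw [integral_const_mul, h2]
  simp only [finrank_euclideanSpace, Fintype.card_fin, smul_eq_mul]
  rw [abs_of_pos (by positivity), neg_add, Real.rpow_add ht, Real.rpow_neg ht.le (n : ℝ),
    Real.rpow_natCast]
  ring

/-- Euler's identity for the homogeneous measure `w(x) dx`. -/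
lemma IsHomogeneousWeight.integral_fderiv_self (hw : IsHomogeneousWeight w α)
    (h : HessianBound w 0) {φ : Rn n → ℝ} (hφ : ContDiff ℝ 1 φ) {c C : ℝ} (hc : 0 < c)
    (hφC : ∀ x, ‖φ x‖ ≤ C * Real.exp (-(c * ‖x‖ ^ 2)))
    (hφC' : ∀ x, ‖fderiv ℝ φ x x‖ ≤ C * Real.exp (-(c * ‖x‖ ^ 2))) :
    ∫ x, fderiv ℝ φ x x ∂wMeasure w = -((n : ℝ) + α) * ∫ x, φ x ∂wMeasure w := by
  have hC : 0 ≤ C := by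
    have := (norm_nonneg _).trans (hφC 0)
    simpa using this
  have hd : Continuous (fderiv ℝ φ) := hφ.continuous_fderiv (by norm_num)
  have hcont := hφ.continuous
  -- The integral of `φ(t x)` is differentiated at `t = 1`, and the result is compared with the
  -- scaling law; no boundary term arises. On `t > 1/2` one has `t⁻¹ ≤ 2` and `t² ≥ 1/4`, whence the
  -- `2C` and `c/4` in the dominating function.
  have key := hasDerivAt_integral_of_dominated_loc_of_deriv_le (μ := wMeasure w)
    (F := fun (t : ℝ) x => φ (t • x)) (F' := fun t x => fderiv ℝ φ (t • x) x) (x₀ := (1 : ℝ))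
    (s := Set.Ioi (1 / 2)) (bound := fun x => 2 * C * Real.exp (-(c / 4 * ‖x‖ ^ 2)))
    (Ioi_mem_nhds (by norm_num)) (by
      filter_upwards with t
      exact Continuous.aestronglyMeasurable (by fun_prop))
    (by simpa using hw.integrable_of_le_exp h hcont.aestronglyMeasurable hc hφC)
    (Continuous.aestronglyMeasurable (by fun_prop))
    (by
      filter_upwards with x t ht
      have ht0 : (1 : ℝ) / 2 < t := ht
      have ht1 : 0 < t := by linarith
      have h1 : fderiv ℝ φ (t • x) x = t⁻¹ * fderiv ℝ φ (t • x) (t • x) := by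
        rw [map_smul, smul_eq_mul, inv_mul_cancel_left₀ ht1.ne']
      rw [h1, norm_mul, norm_inv, Real.norm_of_nonneg ht1.le]
      have h2 : t⁻¹ ≤ 2 := by
        rw [inv_le_comm₀ ht1 (by norm_num)]; linarith
      have h3 : C * Real.exp (-(c * ‖t • x‖ ^ 2)) ≤ C * Real.exp (-(c / 4 * ‖x‖ ^ 2)) := by
        refine mul_le_mul_of_nonneg_left (Real.exp_le_exp.2 (neg_le_neg ?_)) hC
        rw [norm_smul, mul_pow, Real.norm_of_nonneg ht1.le]
        have : (1 : ℝ) / 4 ≤ t ^ 2 := by nlinarith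
        calc c / 4 * ‖x‖ ^ 2 = c * (1 / 4 * ‖x‖ ^ 2) := by ring
          _ ≤ c * (t ^ 2 * ‖x‖ ^ 2) := by gcongr
      calc t⁻¹ * ‖fderiv ℝ φ (t • x) (t • x)‖ ≤ 2 * (C * Real.exp (-(c / 4 * ‖x‖ ^ 2))) :=
            mul_le_mul h2 ((hφC' _).trans h3) (norm_nonneg _) (by norm_num)
        _ = _ := by ring)
    ((hw.integrable_exp h (by positivity)).const_mul _)
    (by
      filter_upwards with x t _
      have h1 : HasDerivAt (fun t : ℝ => t • x) x t := by
        simpa using (hasDerivAt_id t).smul_const x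
      exact ((hφ.differentiable (by norm_num)).differentiableAt).hasFDerivAt.comp_hasDerivAt t h1)
  have h1 := key.2
  simp only [one_smul] at h1
  have h2 : HasDerivAt (fun t : ℝ => t ^ (-((n : ℝ) + α)) * ∫ x, φ x ∂wMeasure w)
      (-((n : ℝ) + α) * ∫ x, φ x ∂wMeasure w) 1 := by
    simpa using (Real.hasDerivAt_rpow_const (p := -((n : ℝ) + α))
      (Or.inl (one_ne_zero (α := ℝ)))).mul_const (∫ x, φ x ∂wMeasure w)
  refine h1.unique (h2.congr_of_eventuallyEq ?_)
  filter_upwards [Ioi_mem_nhds (zero_lt_one (α := ℝ))] with t ht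
  exact hw.integral_comp_smul φ ht

lemma inner_gradient (u : Rn n → ℝ) (x y : Rn n) : inner ℝ (gradient u x) y = fderiv ℝ u x y := by
  rw [gradient, InnerProductSpace.toDual_symm_apply]

lemma continuous_gradient {u : Rn n → ℝ} (hu : ContDiff ℝ 1 u) : Continuous (gradient u) :=
  (InnerProductSpace.toDual ℝ (Rn n)).symm.continuous.comp (hu.continuous_fderiv (by norm_num))

lemma hasCompactSupport_gradient {u : Rn n → ℝ} (hu : HasCompactSupport u) :
    HasCompactSupport (gradient u) :=
  (hu.fderiv (𝕜 := ℝ)).comp_left (map_zero (InnerProductSpace.toDual ℝ (Rn n)).symm)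

lemma hasFDerivAt_exp_mul_norm_sq (b : ℝ) (x : Rn n) :
    HasFDerivAt (fun x : Rn n => Real.exp (b * ‖x‖ ^ 2))
      ((2 * b * Real.exp (b * ‖x‖ ^ 2)) • innerSL ℝ x) x := by
  convert! ((hasStrictFDerivAt_norm_sq x).hasFDerivAt.const_mul b).exp using 1
  ext y
  simp
  ring

lemma gradient_mul_exp {u : Rn n → ℝ} {x : Rn n} (hu : DifferentiableAt ℝ u x) (b : ℝ) :
    gradient (fun x => u x * Real.exp (b * ‖x‖ ^ 2)) x =
      Real.exp (b * ‖x‖ ^ 2) • (gradient u x + (2 * b * u x) • x) := by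
  refine ext_inner_right ℝ fun y => ?_
  rw [inner_gradient, (hu.hasFDerivAt.fun_mul (hasFDerivAt_exp_mul_norm_sq b x)).fderiv,
    inner_smul_left, inner_add_left, inner_gradient, inner_smul_left]
  simp
  ring

/-- Euler's identity for `u²`; it evaluates the cross term in `|∇(u e^{b|x|²/2})|²`. -/
lemma IsHomogeneousWeight.integral_mul_inner_gradient (hw : IsHomogeneousWeight w α)
    (h : HessianBound w 0) {u : Rn n → ℝ} (hu : ContDiff ℝ 1 u) (hs : HasCompactSupport u) :
    ∫ x, 2 * u x * inner ℝ (gradient u x) x ∂wMeasure w =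
      -((n : ℝ) + α) * ∫ x, u x ^ 2 ∂wMeasure w := by
  have hc : ContDiff ℝ 1 (fun x => u x ^ 2) := hu.pow 2
  have hs2 : HasCompactSupport (fun x => u x ^ 2) :=
    hs.comp_left (g := fun y : ℝ => y ^ 2) (by simp)
  have hd : ∀ x, fderiv ℝ (fun x => u x ^ 2) x x = 2 * u x * inner ℝ (gradient u x) x := by
    intro x
    rw [inner_gradient,
      (((hu.differentiable (by norm_num)).differentiableAt (x := x)).hasFDerivAt.pow 2).fderiv]
    simp
  have hgs : HasCompactSupport (fun x => 2 * u x * inner ℝ (gradient u x) x) := by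
    refine HasCompactSupport.mul_right (f := fun x => 2 * u x) ?_
    exact hs.mul_left (f := fun _ => (2 : ℝ))
  have hgc : Continuous (fun x => 2 * u x * inner ℝ (gradient u x) x) := by
    have := continuous_gradient hu
    have := hu.continuous
    fun_prop
  obtain ⟨C, hC⟩ := exists_le_exp_of_hasCompactSupport hc.continuous hs2
  obtain ⟨C', hC'⟩ := exists_le_exp_of_hasCompactSupport hgc hgs
  have := hw.integral_fderiv_self h hc one_pos (C := max C C')
    (fun x => (hC x).trans (by gcongr; exact le_max_left _ _))
    (fun x => by rw [hd]; exact (hC' x).trans (by gcongr; exact le_max_right _ _))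
  simpa only [hd] using this

lemma integral_gaussMeasure (w : Rn n → ℝ) (b : ℝ) (F : Rn n → ℝ) :
    ∫ x, F x ∂gaussMeasure w b = ∫ x, Real.exp (-(b * ‖x‖ ^ 2)) * F x ∂wMeasure w := by
  have h := integral_withDensity_eq_integral_smul (μ := wMeasure w)
    (f := fun x => (Real.exp (-(b * ‖x‖ ^ 2))).toNNReal) (by fun_prop) F
  refine h.trans (integral_congr_ae ?_)
  filter_upwards
  intro x
  rw [NNReal.smul_def, Real.coe_toNNReal _ (Real.exp_nonneg _), smul_eq_mul]

lemma IsHomogeneousWeight.isFiniteMeasure_gaussMeasure (hw : IsHomogeneousWeight w α)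
    (h : HessianBound w 0) {b : ℝ} (hb : 0 < b) : IsFiniteMeasure (gaussMeasure w b) :=
  isFiniteMeasure_withDensity_ofReal (hw.integrable_exp h hb).2

lemma IsHomogeneousWeight.gaussMeasure_real_univ_pos (hw : IsHomogeneousWeight w α)
    (h : HessianBound w 0) {b : ℝ} (hb : 0 < b) : 0 < (gaussMeasure w b).real Set.univ := by
  have := hw.isFiniteMeasure_gaussMeasure h hb
  refine ENNReal.toReal_pos (fun h0 => hw.wMeasure_ne_zero ?_) (measure_ne_top _ _)
  have h2 := (withDensity_apply_eq_zero (μ := wMeasure w)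
    (f := fun x => ENNReal.ofReal (Real.exp (-(b * ‖x‖ ^ 2)))) (s := Set.univ)
    (by fun_prop)).1 h0
  rw [← Measure.measure_univ_eq_zero]
  convert h2 using 2
  ext x
  simp [Real.exp_pos]

/-- The stability inequality for smooth compactly supported functions at a fixed scale. -/
lemma IsHomogeneousWeight.exists_integral_sub_gaussian_sq_le (hw : IsHomogeneousWeight w α)
    (h : HessianBound w 0) {u : Rn n → ℝ} (hu : ContDiff ℝ 2 u) (hs : HasCompactSupport u)
    {b : ℝ} (hb : 0 < b) :
    ∃ c : ℝ, ∫ x, (u x - c * Real.exp (-(b / 2 * ‖x‖ ^ 2))) ^ 2 ∂wMeasure w ≤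
      1 / (2 * b) * ∫ x, ‖gradient u x‖ ^ 2 ∂wMeasure w +
        b / 2 * ∫ x, (‖x‖ * u x) ^ 2 ∂wMeasure w -
        ((n : ℝ) + α) / 2 * ∫ x, u x ^ 2 ∂wMeasure w := by
  have hfin := hw.isFiniteMeasure_gaussMeasure h hb
  have hu1 : ContDiff ℝ 1 u := hu.of_le (by norm_num)
  have hgc := continuous_gradient hu1
  have huc := hu.continuous
  have hgs := hasCompactSupport_gradient hs
  -- Dividing by the Gaussian turns distance to its multiples in `L²(w)` into distance to constants
  -- in `L²(e^{-b|x|²} w)`, to which the Poincaré inequality applies.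
  set v : Rn n → ℝ := fun x => u x * Real.exp (b / 2 * ‖x‖ ^ 2)
  have hv : ContDiff ℝ 2 v :=
    hu.mul (Real.contDiff_exp.comp (contDiff_const.mul (contDiff_norm_sq ℝ)))
  have hvs : HasCompactSupport v := hs.mul_right
  have hv1 : ContDiff ℝ 1 v := hv.of_le (by norm_num)
  have hGc := continuous_gradient hv1
  obtain ⟨M₁, hM₁⟩ := hv.continuous.bounded_above_of_compact_support hvs
  obtain ⟨M₂, hM₂⟩ := hGc.bounded_above_of_compact_support (hasCompactSupport_gradient hvs)
  obtain ⟨L, hL⟩ := exists_forall_sub_le_of_hasCompactSupport hv hvs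
  obtain ⟨c, hc⟩ := exists_integral_sub_sq_le hw.measurable hw.nonneg (hw.mul_le_midpoint_sq h) hb
    (hw.gaussMeasure_real_univ_pos h hb) hv.continuous.measurable hGc.measurable
    (M := max M₁ (M₂ ^ 2)) (fun x => (hM₁ x).trans (le_max_left _ _))
    (fun x => (pow_le_pow_left₀ (norm_nonneg _) (hM₂ x) 2).trans (le_max_right _ _)) hL
  refine ⟨c, ?_⟩
  rw [integral_gaussMeasure, integral_gaussMeasure] at hc
  have e1 : ∀ x, Real.exp (-(b * ‖x‖ ^ 2)) * (v x - c) ^ 2 =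
      (u x - c * Real.exp (-(b / 2 * ‖x‖ ^ 2))) ^ 2 := by
    intro x
    have h1 : Real.exp (-(b * ‖x‖ ^ 2)) = Real.exp (-(b / 2 * ‖x‖ ^ 2)) ^ 2 := by
      rw [← Real.exp_nat_mul]; congr 1; push_cast; ring
    have h2 : Real.exp (-(b / 2 * ‖x‖ ^ 2)) * Real.exp (b / 2 * ‖x‖ ^ 2) = 1 := by
      rw [← Real.exp_add, neg_add_cancel, Real.exp_zero]
    rw [h1, ← mul_pow]
    congr 1
    simp only [v]
    linear_combination u x * h2
  have e2 : ∀ x, Real.exp (-(b * ‖x‖ ^ 2)) * ‖gradient v x‖ ^ 2 =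
      ‖gradient u x‖ ^ 2 + b * (2 * u x * inner ℝ (gradient u x) x) + b ^ 2 * (‖x‖ * u x) ^ 2 := by
    intro x
    have h1 : Real.exp (-(b * ‖x‖ ^ 2)) * Real.exp (b / 2 * ‖x‖ ^ 2) ^ 2 = 1 := by
      rw [← Real.exp_nat_mul, ← Real.exp_add]
      simp only [Nat.cast_ofNat, Real.exp_eq_one_iff]; ring
    rw [gradient_mul_exp (hu1.differentiable (by norm_num)).differentiableAt, norm_smul, mul_pow,
      ← mul_assoc, Real.norm_of_nonneg (Real.exp_nonneg _), h1, one_mul, norm_add_sq_real,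
      inner_smul_right, norm_smul, mul_pow, Real.norm_eq_abs, sq_abs]
    ring
  simp only [e1, e2] at hc
  have i1 : Integrable (fun x => ‖gradient u x‖ ^ 2) (wMeasure w) :=
    hw.integrable_of_hasCompactSupport h (by fun_prop) (hgs.comp_left (g := fun y => ‖y‖ ^ 2) (by simp))
  have i2 : Integrable (fun x => 2 * u x * inner ℝ (gradient u x) x) (wMeasure w) :=
    hw.integrable_of_hasCompactSupport h (by fun_prop)
      (HasCompactSupport.mul_right (hs.mul_left (f := fun _ => (2 : ℝ))))
  have i3 : Integrable (fun x => (‖x‖ * u x) ^ 2) (wMeasure w) :=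
    hw.integrable_of_hasCompactSupport h (by fun_prop)
      ((hs.mul_left : HasCompactSupport ((fun x : Rn n => ‖x‖) * u)).comp_left
        (g := fun y : ℝ => y ^ 2) (by simp))
  rw [integral_add (by fun_prop) (by fun_prop), integral_add (by fun_prop) (by fun_prop),
    integral_const_mul, integral_const_mul, hw.integral_mul_inner_gradient h hu1 hs] at hc
  refine hc.trans (le_of_eq ?_)
  field_simp
  ring

end Euler

/-! ### `L²` norms as square roots of integrals. -/

section SquareIntegrable

variable {X : Type*} [MeasurableSpace X] {μ : Measure X} {E : Type*} [NormedAddCommGroup E]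

lemma eLpNorm_two_eq_ofReal_sqrt {F : X → E} (hF : MemLp F 2 μ) :
    eLpNorm F 2 μ = ENNReal.ofReal √(∫ x, ‖F x‖ ^ 2 ∂μ) := by
  rw [hF.eLpNorm_eq_integral_rpow_norm two_ne_zero (by simp), Real.sqrt_eq_rpow]
  simp

lemma toReal_eLpNorm_two {F : X → E} (hF : MemLp F 2 μ) :
    (eLpNorm F 2 μ).toReal = √(∫ x, ‖F x‖ ^ 2 ∂μ) := by
  rw [eLpNorm_two_eq_ofReal_sqrt hF, ENNReal.toReal_ofReal (Real.sqrt_nonneg _)]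

lemma sqrt_integral_norm_add_sq_le {F G : X → E} (hF : MemLp F 2 μ) (hG : MemLp G 2 μ) :
    √(∫ x, ‖F x + G x‖ ^ 2 ∂μ) ≤ √(∫ x, ‖F x‖ ^ 2 ∂μ) + √(∫ x, ‖G x‖ ^ 2 ∂μ) := by
  rw [← toReal_eLpNorm_two hF, ← toReal_eLpNorm_two hG, show √(∫ x, ‖F x + G x‖ ^ 2 ∂μ) = _ from (toReal_eLpNorm_two (hF.add hG)).symm,
    ← ENNReal.toReal_add hF.2.ne hG.2.ne]
  exact ENNReal.toReal_mono (ENNReal.add_ne_top.2 ⟨hF.2.ne, hG.2.ne⟩)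
    (eLpNorm_add_le hF.1 hG.1 (by norm_num))

lemma tendsto_integral_norm_sq {F : ℕ → X → E} {G : X → E} (hF : ∀ k, MemLp (F k) 2 μ)
    (hG : MemLp G 2 μ) (h : Tendsto (fun k => eLpNorm (fun x => F k x - G x) 2 μ) atTop (𝓝 0)) :
    Tendsto (fun k => ∫ x, ‖F k x‖ ^ 2 ∂μ) atTop (𝓝 (∫ x, ‖G x‖ ^ 2 ∂μ)) := by
  have h1 := ((Lp.tendsto_Lp_iff_tendsto_eLpNorm'' F hF G hG).2 h).norm.pow 2
  simpa only [Lp.norm_toLp, toReal_eLpNorm_two (hF _), toReal_eLpNorm_two hG,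
    Real.sq_sqrt (integral_nonneg fun x => sq_nonneg ‖G x‖),
    Real.sq_sqrt (integral_nonneg fun x => sq_nonneg ‖F _ x‖)] using h1

end SquareIntegrable

/-! ### Passage from the test class to `S_w`, and optimization of the scale. -/

section Closure

variable {n : ℕ} {w : Rn n → ℝ} {α : ℝ}

lemma IsHomogeneousWeight.memLp_of_hasCompactSupport (hw : IsHomogeneousWeight w α)
    (h : HessianBound w 0) {E : Type*} [NormedAddCommGroup E] {F : Rn n → E} (hF : Continuous F)
    (hs : HasCompactSupport F) : MemLp F 2 (wMeasure w) := by
  have hm : AEStronglyMeasurable F (wMeasure w) := by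
    borelize E
    exact hF.aestronglyMeasurable
  rw [memLp_two_iff_integrable_sq_norm hm]
  exact hw.integrable_of_hasCompactSupport h (by fun_prop)
    (hs.comp_left (g := fun y => ‖y‖ ^ 2) (by simp))

/-- The right side of the stability estimate at `b = 1` is nonnegative, so `(n + α)∫u²w ≤ ∫|∇u|²w +
∫|x|²u²w`. Thus the norm of `S_w` controls that of `L²(w)`. -/
lemma IsHomogeneousWeight.eLpNorm_le_of_hasCompactSupport (hw : IsHomogeneousWeight w α)
    (h : HessianBound w 0) (hN : 0 < (n : ℝ) + α) {u : Rn n → ℝ} (hu : ContDiff ℝ 2 u)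
    (hs : HasCompactSupport u) :
    eLpNorm u 2 (wMeasure w) ≤ ENNReal.ofReal (√((n : ℝ) + α))⁻¹ *
      (eLpNorm (gradient u) 2 (wMeasure w) + eLpNorm (fun x => ‖x‖ * u x) 2 (wMeasure w)) := by
  have hgc := continuous_gradient (hu.of_le (m := 1) (by norm_num))
  have huc := hu.continuous
  have m1 := hw.memLp_of_hasCompactSupport h huc hs
  have m2 := hw.memLp_of_hasCompactSupport h hgc (hasCompactSupport_gradient hs)
  have m3 : MemLp (fun x => ‖x‖ * u x) 2 (wMeasure w) :=
    hw.memLp_of_hasCompactSupport h (by fun_prop)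
      (hs.mul_left : HasCompactSupport ((fun x : Rn n => ‖x‖) * u))
  rw [eLpNorm_two_eq_ofReal_sqrt m1, eLpNorm_two_eq_ofReal_sqrt m2, eLpNorm_two_eq_ofReal_sqrt m3,
    ← ENNReal.ofReal_add (by positivity) (by positivity), ← ENNReal.ofReal_mul (by positivity)]
  apply ENNReal.ofReal_le_ofReal
  obtain ⟨c, hc⟩ := hw.exists_integral_sub_gaussian_sq_le h hu hs one_pos
  have h0 : 0 ≤ ∫ x, (u x - c * Real.exp (-(1 / 2 * ‖x‖ ^ 2))) ^ 2 ∂wMeasure w :=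
    integral_nonneg fun x => sq_nonneg _
  have h1 := h0.trans hc
  simp only [Real.norm_eq_abs, sq_abs]
  set A := ∫ x, ‖gradient u x‖ ^ 2 ∂wMeasure w
  set B := ∫ x, (‖x‖ * u x) ^ 2 ∂wMeasure w
  have hA : 0 ≤ A := integral_nonneg fun x => sq_nonneg _
  have hB : 0 ≤ B := integral_nonneg fun x => sq_nonneg _
  rw [← div_eq_inv_mul, le_div_iff₀ (Real.sqrt_pos.2 hN), mul_comm, ← Real.sqrt_mul hN.le]
  apply Real.sqrt_le_iff.2
  refine ⟨by positivity, ?_⟩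
  have h2 := Real.sq_sqrt hA
  have h3 := Real.sq_sqrt hB
  have h4 : 0 ≤ √A * √B := by positivity
  nlinarith

lemma ae_ne_zero_wMeasure (hn : 1 ≤ n) (w : Rn n → ℝ) : ∀ᵐ x ∂wMeasure w, x ≠ 0 := by
  have : Nonempty (Fin n) := ⟨⟨0, hn⟩⟩
  refine withDensity_absolutelyContinuous _ _ ?_
  simp

lemma gradient_sub {u v : Rn n → ℝ} {x : Rn n} (hu : DifferentiableAt ℝ u x)
    (hv : DifferentiableAt ℝ v x) : gradient (u - v) x = gradient u x - gradient v x := by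
  simp only [gradient]
  rw [fderiv_sub hu hv, map_sub]

/-- An element of `S_w` is square integrable and is approximated by the test class also in
`L²(w dx)`. -/
lemma IsHomogeneousWeight.exists_approx (hw : IsHomogeneousWeight w α) (h : HessianBound w 0)
    (hn : 1 ≤ n) (hN : 0 < (n : ℝ) + α) {f : Rn n → ℝ} {g : Rn n → Rn n} (hf : MemS w f g) :
    MemLp f 2 (wMeasure w) ∧ ∃ u : ℕ → Rn n → ℝ, (∀ k, u k ∈ TestClass w) ∧
      Tendsto (fun k => eLpNorm (fun x => u k x - f x) 2 (wMeasure w)) atTop (𝓝 0) ∧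
      Tendsto (fun k => eLpNorm (fun x => gradient (u k) x - g x) 2 (wMeasure w)) atTop (𝓝 0) ∧
      Tendsto (fun k => eLpNorm (fun x => ‖x‖ * u k x - ‖x‖ * f x) 2 (wMeasure w)) atTop
        (𝓝 0) := by
  set μ := wMeasure w
  have hx0 : ∀ᵐ x ∂μ, x ≠ 0 := ae_ne_zero_wMeasure hn w
  have hfm : AEStronglyMeasurable f μ := by
    -- Only `|x| f` is known to be measurable; dividing by `|x|` is harmless because the origin is a
    -- null set.
    have h1 : AEStronglyMeasurable (fun x => ‖x‖⁻¹ * (‖x‖ * f x)) μ :=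
      (Measurable.aestronglyMeasurable (by fun_prop)).mul hf.memLp_mul.1
    refine h1.congr ?_
    filter_upwards [hx0] with x hx
    rw [inv_mul_cancel_left₀ (norm_ne_zero_iff.2 hx)]
  have hpos : ∀ k : ℕ, (0 : ℝ≥0∞) < ((k : ℝ≥0∞) + 1)⁻¹ := fun k => by
    simp only [ENNReal.inv_pos]; finiteness
  choose u huA hu using fun k : ℕ => hf.approx _ (hpos k)
  have hlim : Tendsto (fun k : ℕ => ((k : ℝ≥0∞) + 1)⁻¹) atTop (𝓝 0) := by
    have := (tendsto_add_atTop_iff_nat 1).2 ENNReal.tendsto_inv_nat_nhds_zero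
    simpa using this
  have lg : Tendsto (fun k => eLpNorm (fun x => gradient (u k) x - g x) 2 μ) atTop (𝓝 0) :=
    tendsto_of_tendsto_of_tendsto_of_le_of_le tendsto_const_nhds hlim (fun _ => zero_le)
      fun k => le_self_add.trans (hu k).le
  have hu' : ∀ k, eLpNorm (fun x => ‖x‖ * u k x - ‖x‖ * f x) 2 μ ≤ ((k : ℝ≥0∞) + 1)⁻¹ := by
    intro k
    simp only [← mul_sub]
    exact le_add_self.trans (hu k).le
  have lx : Tendsto (fun k => eLpNorm (fun x => ‖x‖ * u k x - ‖x‖ * f x) 2 μ) atTop (𝓝 0) :=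
    tendsto_of_tendsto_of_tendsto_of_le_of_le tendsto_const_nhds hlim (fun _ => zero_le) hu'
  have hc : ∀ k, Continuous (u k) := fun k => (huA k).1.continuous
  have hg : ∀ k, Continuous (gradient (u k)) := fun k =>
    continuous_gradient ((huA k).1.of_le (by norm_cast))
  -- Almost everywhere convergence of a subsequence identifies the `L²(w)` limit of `u k` as `f`.
  obtain ⟨ns, hns, hae⟩ := (tendstoInMeasure_of_tendsto_eLpNorm (p := 2) two_ne_zero
    (f := fun k x => ‖x‖ * u k x) (g := fun x => ‖x‖ * f x)
    (fun k => Continuous.aestronglyMeasurable (by have := hc k; fun_prop)) hf.memLp_mul.1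
    lx).exists_seq_tendsto_ae
  set C := ENNReal.ofReal (√((n : ℝ) + α))⁻¹
  have cauchy : ∀ k j, k ≤ j → eLpNorm (u k - u j) 2 μ ≤ C * (4 * ((k : ℝ≥0∞) + 1)⁻¹) := by
    intro k j hkj
    have hjk : ((j : ℝ≥0∞) + 1)⁻¹ ≤ ((k : ℝ≥0∞) + 1)⁻¹ := by gcongr
    have b := hw.eLpNorm_le_of_hasCompactSupport h hN
      ((((huA k).1.sub (huA j).1)).of_le (by norm_cast) : ContDiff ℝ 2 (u k - u j))
      ((huA k).2.1.sub (huA j).2.1)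
    refine b.trans ?_
    gcongr
    have e1 : eLpNorm (gradient (u k - u j)) 2 μ ≤ ((k : ℝ≥0∞) + 1)⁻¹ + ((j : ℝ≥0∞) + 1)⁻¹ := by
      have : gradient (u k - u j) = (fun x => gradient (u k) x - g x) -
          (fun x => gradient (u j) x - g x) := by
        ext1 x
        rw [gradient_sub ((huA k).1.differentiable (by simp)).differentiableAt
          ((huA j).1.differentiable (by simp)).differentiableAt]
        simp
      rw [this]
      exact (eLpNorm_sub_le ((hg k).aestronglyMeasurable.sub hf.memLp_grad.1)
        ((hg j).aestronglyMeasurable.sub hf.memLp_grad.1) (by norm_num)).trans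
        (add_le_add (le_self_add.trans (hu k).le) (le_self_add.trans (hu j).le))
    have e2 : eLpNorm (fun x => ‖x‖ * (u k - u j) x) 2 μ ≤
        ((k : ℝ≥0∞) + 1)⁻¹ + ((j : ℝ≥0∞) + 1)⁻¹ := by
      have : (fun x => ‖x‖ * (u k - u j) x) = (fun x => ‖x‖ * u k x - ‖x‖ * f x) -
          (fun x => ‖x‖ * u j x - ‖x‖ * f x) := by
        ext x
        simp only [Pi.sub_apply]; ring
      rw [this]
      exact (eLpNorm_sub_le ((Continuous.aestronglyMeasurable (by have := hc k; fun_prop)).sub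
        hf.memLp_mul.1) ((Continuous.aestronglyMeasurable (by have := hc j; fun_prop)).sub
        hf.memLp_mul.1) (by norm_num)).trans (add_le_add (hu' k) (hu' j))
    calc _ ≤ (((k : ℝ≥0∞) + 1)⁻¹ + ((k : ℝ≥0∞) + 1)⁻¹) +
          (((k : ℝ≥0∞) + 1)⁻¹ + ((k : ℝ≥0∞) + 1)⁻¹) :=
          add_le_add (e1.trans (by gcongr)) (e2.trans (by gcongr))
      _ = _ := by ring
  -- Fatou's lemma along the subsequence transfers the Cauchy bound to the limit.
  have close : ∀ k, eLpNorm (fun x => u k x - f x) 2 μ ≤ C * (4 * ((k : ℝ≥0∞) + 1)⁻¹) := by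
    intro k
    refine Lp.eLpNorm_le_of_ae_tendsto (u := atTop) (f := fun j => u k - u (ns j)) ?_ ?_ ?_
    · filter_upwards [eventually_ge_atTop k] with j hj
      exact cauchy k (ns j) (hj.trans (hns.id_le j))
    · exact fun j => ((hc k).sub (hc _)).aestronglyMeasurable
    · filter_upwards [hx0, hae] with x hx hxl
      refine tendsto_const_nhds.sub ?_
      have := hxl.const_mul ‖x‖⁻¹
      simpa only [inv_mul_cancel_left₀ (norm_ne_zero_iff.2 hx)] using this
  refine ⟨?_, u, huA, ?_, lg, lx⟩
  · have h1 : MemLp (fun x => u 0 x - f x) 2 μ :=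
      ⟨(hc 0).aestronglyMeasurable.sub hfm, (close 0).trans_lt (by simp [C]; finiteness)⟩
    have h2 := (hw.memLp_of_hasCompactSupport h (hc 0) (huA 0).2.1).sub h1
    convert h2 using 1
    ext x
    simp
  · have h1 : Tendsto (fun k : ℕ => C * (4 * ((k : ℝ≥0∞) + 1)⁻¹)) atTop (𝓝 (C * (4 * 0))) :=
      ENNReal.Tendsto.const_mul (ENNReal.Tendsto.const_mul hlim (Or.inr (by simp)))
        (Or.inr (by simp [C]))
    simp only [mul_zero] at h1
    exact tendsto_of_tendsto_of_tendsto_of_le_of_le tendsto_const_nhds h1 (fun _ => zero_le) close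

lemma bddBelow_range_gaussDist (f : Rn n → ℝ) : BddBelow (Set.range fun p : ℝ × {l : ℝ // l ≠ 0} =>
    √(∫ x, |f x - p.1 * Real.exp (-(‖x‖ ^ 2 / (2 * (p.2 : ℝ) ^ 2)))| ^ 2 ∂wMeasure w)) :=
  ⟨0, by rintro _ ⟨p, rfl⟩; positivity⟩

lemma gaussDist_nonneg (f : Rn n → ℝ) : 0 ≤ gaussDist w f :=
  Real.iInf_nonneg fun _ => Real.sqrt_nonneg _

lemma gaussDist_le (f : Rn n → ℝ) (c : ℝ) {b : ℝ} (hb : 0 < b) : gaussDist w f ≤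
    √(∫ x, ‖f x - c * Real.exp (-(b / 2 * ‖x‖ ^ 2))‖ ^ 2 ∂wMeasure w) := by
  refine (ciInf_le (bddBelow_range_gaussDist f)
    -- The parameter `l = b^{-1/2}` gives `|x|²/(2l²) = b|x|²/2`.
    (c, ⟨(√b)⁻¹, inv_ne_zero (Real.sqrt_pos.2 hb).ne'⟩)).trans (le_of_eq ?_)
  have h1 : ∀ x : Rn n, ‖x‖ ^ 2 / (2 * (√b)⁻¹ ^ 2) = b / 2 * ‖x‖ ^ 2 := by
    intro x
    rw [inv_pow, Real.sq_sqrt hb.le]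
    field_simp
  simp only [h1, Real.norm_eq_abs]

lemma IsHomogeneousWeight.memLp_gaussian (hw : IsHomogeneousWeight w α) (h : HessianBound w 0)
    (c : ℝ) {b : ℝ} (hb : 0 < b) :
    MemLp (fun x => c * Real.exp (-(b / 2 * ‖x‖ ^ 2))) 2 (wMeasure w) := by
  rw [memLp_two_iff_integrable_sq (Continuous.aestronglyMeasurable (by fun_prop))]
  refine ((hw.integrable_exp h hb).const_mul (c ^ 2)).congr ?_
  filter_upwards
  intro x
  rw [mul_pow, ← Real.exp_nat_mul]
  congr 2
  push_cast
  ring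

lemma IsHomogeneousWeight.gaussDist_sq_le (hw : IsHomogeneousWeight w α) (h : HessianBound w 0)
    (hn : 1 ≤ n) (hN : 0 < (n : ℝ) + α) {f : Rn n → ℝ} {g : Rn n → Rn n} (hf : MemS w f g)
    {b : ℝ} (hb : 0 < b) : gaussDist w f ^ 2 ≤
      1 / (2 * b) * ∫ x, ‖g x‖ ^ 2 ∂wMeasure w + b / 2 * ∫ x, ‖‖x‖ * f x‖ ^ 2 ∂wMeasure w -
        ((n : ℝ) + α) / 2 * ∫ x, ‖f x‖ ^ 2 ∂wMeasure w := by
  obtain ⟨hfL, u, huA, l1, l2, l3⟩ := hw.exists_approx h hn hN hf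
  have hu2 : ∀ k, ContDiff ℝ 2 (u k) := fun k => (huA k).1.of_le (by norm_cast)
  have hc : ∀ k, Continuous (u k) := fun k => (huA k).1.continuous
  have m1 : ∀ k, MemLp (u k) 2 (wMeasure w) := fun k =>
    hw.memLp_of_hasCompactSupport h (hc k) (huA k).2.1
  have m2 : ∀ k, MemLp (gradient (u k)) 2 (wMeasure w) := fun k =>
    hw.memLp_of_hasCompactSupport h (continuous_gradient ((hu2 k).of_le (by norm_num)))
      (hasCompactSupport_gradient (huA k).2.1)
  have m3 : ∀ k, MemLp (fun x => ‖x‖ * u k x) 2 (wMeasure w) := fun k =>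
    hw.memLp_of_hasCompactSupport h (by have := hc k; fun_prop)
      ((huA k).2.1.mul_left : HasCompactSupport ((fun x : Rn n => ‖x‖) * u k))
  have t1 := tendsto_integral_norm_sq m1 hfL l1
  have t2 := tendsto_integral_norm_sq m2 hf.memLp_grad l2
  have t3 := tendsto_integral_norm_sq m3 hf.memLp_mul l3
  set D : ℕ → ℝ := fun k => 1 / (2 * b) * ∫ x, ‖gradient (u k) x‖ ^ 2 ∂wMeasure w +
    b / 2 * ∫ x, ‖‖x‖ * u k x‖ ^ 2 ∂wMeasure w - ((n : ℝ) + α) / 2 * ∫ x, ‖u k x‖ ^ 2 ∂wMeasure w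
  have tD : Tendsto D atTop _ := ((t2.const_mul (1 / (2 * b))).add (t3.const_mul (b / 2))).sub
    (t1.const_mul (((n : ℝ) + α) / 2))
  have t4 : Tendsto (fun k => √(∫ x, ‖f x - u k x‖ ^ 2 ∂wMeasure w)) atTop (𝓝 0) := by
    have : ∀ k, √(∫ x, ‖f x - u k x‖ ^ 2 ∂wMeasure w) =
        (eLpNorm (fun x => u k x - f x) 2 (wMeasure w)).toReal := by
      intro k
      rw [toReal_eLpNorm_two (F := fun x => u k x - f x) ((m1 k).sub hfL)]
      simp only [norm_sub_rev]
    simp only [this]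
    exact (ENNReal.tendsto_toReal (by simp)).comp l1
  have step : ∀ k, 0 ≤ D k ∧ gaussDist w f ≤ √(∫ x, ‖f x - u k x‖ ^ 2 ∂wMeasure w) + √(D k) := by
    intro k
    obtain ⟨c, hcc⟩ := hw.exists_integral_sub_gaussian_sq_le h (hu2 k) (huA k).2.1 hb
    have hcc' : ∫ x, ‖u k x - c * Real.exp (-(b / 2 * ‖x‖ ^ 2))‖ ^ 2 ∂wMeasure w ≤ D k := by
      simpa only [D, Real.norm_eq_abs, sq_abs] using hcc
    refine ⟨le_trans (integral_nonneg fun x => sq_nonneg _) hcc', ?_⟩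
    refine (gaussDist_le f c hb).trans ?_
    have tri := sqrt_integral_norm_add_sq_le (hfL.sub (m1 k)) ((m1 k).sub (hw.memLp_gaussian h c hb))
    simp only [Pi.sub_apply, sub_add_sub_cancel] at tri
    exact tri.trans (add_le_add le_rfl (Real.sqrt_le_sqrt hcc'))
  have hD0 := ge_of_tendsto' tD fun k => (step k).1
  have hfin := ge_of_tendsto' (t4.add (tD.sqrt)) fun k => (step k).2
  rw [zero_add] at hfin
  exact (Real.le_sqrt (gaussDist_nonneg f) hD0).1 hfin

lemma IsHomogeneousWeight.gaussDist_sq_le_deficit (hw : IsHomogeneousWeight w α)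
    (h : HessianBound w 0) (hn : 1 ≤ n) (hN : 0 < (n : ℝ) + α) {f : Rn n → ℝ} {g : Rn n → Rn n}
    (hf : MemS w f g) : gaussDist w f ^ 2 ≤ deficit w α f g := by
  have e1 : ∀ x, |f x| ^ 2 * ‖x‖ ^ 2 = ‖‖x‖ * f x‖ ^ 2 := by
    intro x
    rw [norm_mul, norm_norm, mul_pow, Real.norm_eq_abs, mul_comm]
  simp only [deficit, e1]
  simp only [← Real.norm_eq_abs (f _)]
  have key := fun {b : ℝ} (hb : 0 < b) => hw.gaussDist_sq_le h hn hN hf hb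
  set A2 := ∫ x, ‖g x‖ ^ 2 ∂wMeasure w
  set B2 := ∫ x, ‖‖x‖ * f x‖ ^ 2 ∂wMeasure w
  set F := ((n : ℝ) + α) / 2 * ∫ x, ‖f x‖ ^ 2 ∂wMeasure w
  have hA : A2 = √A2 ^ 2 := (Real.sq_sqrt (integral_nonneg fun x => sq_nonneg _)).symm
  have hB : B2 = √B2 ^ 2 := (Real.sq_sqrt (integral_nonneg fun x => sq_nonneg _)).symm
  have hA0 := Real.sqrt_nonneg A2
  have hB0 := Real.sqrt_nonneg B2
  set A := √A2
  set B := √B2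
  -- The optimal scale is `b = A/B`; `b = (A + e)/(B + e)` also makes sense when a norm vanishes,
  -- and costs only `O(e)`.
  have step : ∀ e : ℝ, 0 < e → gaussDist w f ^ 2 ≤ A * B + e * ((A + B) / 2) - F := by
    intro e he
    have hAe : 0 < A + e := by linarith
    have hBe : 0 < B + e := by linarith
    have h1 := key (div_pos hAe hBe)
    have h2 : 1 / (2 * ((A + e) / (B + e))) * A2 ≤ A * (B + e) / 2 := by
      rw [hA]
      have : 1 / (2 * ((A + e) / (B + e))) * A ^ 2 = (B + e) / 2 * A * (A / (A + e)) := by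
        field_simp
      rw [this]
      have h3 : A / (A + e) ≤ 1 := (div_le_one hAe).2 (by linarith)
      calc (B + e) / 2 * A * (A / (A + e)) ≤ (B + e) / 2 * A * 1 := by gcongr
        _ = _ := by ring
    have h4 : (A + e) / (B + e) / 2 * B2 ≤ (A + e) * B / 2 := by
      rw [hB]
      have : (A + e) / (B + e) / 2 * B ^ 2 = (A + e) / 2 * B * (B / (B + e)) := by
        field_simp
      rw [this]
      have h3 : B / (B + e) ≤ 1 := (div_le_one hBe).2 (by linarith)
      calc (A + e) / 2 * B * (B / (B + e)) ≤ (A + e) / 2 * B * 1 := by gcongr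
        _ = _ := by ring
    linarith
  have hlim : Tendsto (fun e : ℝ => A * B + e * ((A + B) / 2) - F) (𝓝[>] 0)
      (𝓝 (A * B + 0 * ((A + B) / 2) - F)) :=
    (Continuous.tendsto (by fun_prop) 0).mono_left nhdsWithin_le_nhds
  have := ge_of_tendsto hlim (by filter_upwards [self_mem_nhdsWithin] with e he using step e he)
  linarith

end Closure

/-! ### The function `x_i e^{-|x|²/2}`: membership in `S_w`. -/

section Hermite

variable {n : ℕ} {w : Rn n → ℝ} {α : ℝ}

lemma exists_pow_mul_exp_le (m : ℕ) {b : ℝ} (hb : 0 < b) : ∃ C : ℝ, 0 ≤ C ∧ ∀ x : Rn n,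
    (1 + ‖x‖ ^ 2) ^ m * Real.exp (-(b * ‖x‖ ^ 2)) ≤ C * Real.exp (-(b / 2 * ‖x‖ ^ 2)) := by
  -- The constant comes from `y^m / m! ≤ e^y` at `y = (b/2)(1 + |x|²)`.
  refine ⟨m.factorial * (2 / b) ^ m * Real.exp (b / 2), by positivity, fun x => ?_⟩
  have h1 := Real.pow_div_factorial_le_exp (b / 2 * (1 + ‖x‖ ^ 2)) (by positivity) m
  rw [div_le_iff₀ (by positivity), mul_pow] at h1
  have h2 : (1 + ‖x‖ ^ 2) ^ m = (2 / b) ^ m * ((b / 2) ^ m * (1 + ‖x‖ ^ 2) ^ m) := by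
    rw [← mul_assoc, ← mul_pow]
    field_simp
    simp
  have h3 : Real.exp (b / 2 * (1 + ‖x‖ ^ 2)) * Real.exp (-(b * ‖x‖ ^ 2)) =
      Real.exp (b / 2) * Real.exp (-(b / 2 * ‖x‖ ^ 2)) := by
    rw [← Real.exp_add, ← Real.exp_add]; congr 1; ring
  calc (1 + ‖x‖ ^ 2) ^ m * Real.exp (-(b * ‖x‖ ^ 2))
      ≤ (2 / b) ^ m * (Real.exp (b / 2 * (1 + ‖x‖ ^ 2)) * m.factorial) *
          Real.exp (-(b * ‖x‖ ^ 2)) := by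
        rw [h2]; gcongr
    _ = (2 / b) ^ m * m.factorial *
        (Real.exp (b / 2 * (1 + ‖x‖ ^ 2)) * Real.exp (-(b * ‖x‖ ^ 2))) := by ring
    _ = _ := by rw [h3]; ring

lemma IsHomogeneousWeight.integrable_of_le_pow_mul_exp (hw : IsHomogeneousWeight w α)
    (h : HessianBound w 0) {F : Rn n → ℝ} (hF : Continuous F) (m : ℕ) {b c : ℝ} (hb : 0 < b)
    (hFb : ∀ x, ‖F x‖ ≤ c * ((1 + ‖x‖ ^ 2) ^ m * Real.exp (-(b * ‖x‖ ^ 2)))) :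
    Integrable F (wMeasure w) := by
  have hc : 0 ≤ c := by
    have := (norm_nonneg _).trans (hFb 0)
    simpa using this
  obtain ⟨C, -, hC⟩ := exists_pow_mul_exp_le (n := n) m hb
  refine hw.integrable_of_le_exp h hF.aestronglyMeasurable (half_pos hb) (C := c * C) fun x => ?_
  rw [mul_assoc]
  exact (hFb x).trans (mul_le_mul_of_nonneg_left (hC x) hc)

lemma IsHomogeneousWeight.memLp_of_le_exp (hw : IsHomogeneousWeight w α)
    (h : HessianBound w 0) {E : Type*} [NormedAddCommGroup E] {F : Rn n → E} (hF : Continuous F)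
    {b c : ℝ} (hb : 0 < b) (hFb : ∀ x, ‖F x‖ ≤ c * Real.exp (-(b / 2 * ‖x‖ ^ 2))) :
    MemLp F 2 (wMeasure w) := by
  refine (hw.memLp_gaussian h c hb).mono (by borelize E; exact hF.aestronglyMeasurable) ?_
  filter_upwards
  intro x
  exact (hFb x).trans (le_abs_self _)

lemma abs_apply_le_norm (x : Rn n) (i : Fin n) : |x i| ≤ ‖x‖ := PiLp.norm_apply_le x i

lemma sq_apply_le_norm_sq (x : Rn n) (i : Fin n) : x i ^ 2 ≤ ‖x‖ ^ 2 := by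
  rw [← sq_abs]
  exact pow_le_pow_left₀ (abs_nonneg _) (abs_apply_le_norm x i) 2

lemma hasFDerivAt_comp_norm_sq {ψ : ℝ → ℝ} {ψ' : ℝ} {x : Rn n} (hψ : HasDerivAt ψ ψ' (‖x‖ ^ 2)) :
    HasFDerivAt (fun x : Rn n => ψ (‖x‖ ^ 2)) ((2 * ψ') • innerSL ℝ x) x := by
  convert! hψ.comp_hasFDerivAt x (hasStrictFDerivAt_norm_sq x).hasFDerivAt using 1
  ext y
  simp
  ring

lemma hasFDerivAt_apply (i : Fin n) (x : Rn n) :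
    HasFDerivAt (fun x : Rn n => x i) (EuclideanSpace.proj i : Rn n →L[ℝ] ℝ) x :=
  (EuclideanSpace.proj i : Rn n →L[ℝ] ℝ).hasFDerivAt

lemma gradient_apply_mul_comp_norm_sq (i : Fin n) {ψ : ℝ → ℝ} {ψ' : ℝ} {x : Rn n}
    (hψ : HasDerivAt ψ ψ' (‖x‖ ^ 2)) :
    gradient (fun x : Rn n => x i * ψ (‖x‖ ^ 2)) x =
      ψ (‖x‖ ^ 2) • EuclideanSpace.single i (1 : ℝ) + (2 * x i * ψ') • x := by
  refine ext_inner_right ℝ fun y => ?_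
  rw [inner_gradient, ((hasFDerivAt_apply i x).fun_mul (hasFDerivAt_comp_norm_sq hψ)).fderiv,
    inner_add_left, inner_smul_left, inner_smul_left, EuclideanSpace.inner_single_left]
  simp
  ring

/-- A smooth cutoff of `e^{-s/2}`, equal to it for `s < k` and vanishing for `s > 2k`. -/
def cutoffExp (k : ℝ) (s : ℝ) : ℝ := Real.smoothTransition (2 - s / k) * Real.exp (-(s / 2))

lemma contDiff_cutoffExp (k : ℝ) : ContDiff ℝ ∞ (cutoffExp k) := by
  unfold cutoffExp
  refine ContDiff.mul (Real.smoothTransition.contDiff.comp ?_) (Real.contDiff_exp.comp ?_)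
  · exact contDiff_const.sub (contDiff_id.div_const k)
  · exact (contDiff_id.div_const 2).neg

lemma exists_deriv_smoothTransition_le : ∃ M : ℝ, ∀ s, |deriv Real.smoothTransition s| ≤ M := by
  have hc : Continuous (deriv Real.smoothTransition) :=
    (Real.smoothTransition.contDiff (n := 1)).continuous_deriv (by norm_num)
  have hs : HasCompactSupport (deriv Real.smoothTransition) := by
    refine HasCompactSupport.intro (isCompact_Icc (a := (0 : ℝ)) (b := 1)) fun s hs => ?_
    rw [Set.mem_Icc, not_and_or, not_le, not_le] at hs
    rcases hs with hs | hs
    · have : Real.smoothTransition =ᶠ[𝓝 s] fun _ => 0 := by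
        filter_upwards [Iio_mem_nhds hs] with y hy
          using Real.smoothTransition.zero_of_nonpos (le_of_lt hy)
      rw [this.deriv_eq, deriv_const]
    · have : Real.smoothTransition =ᶠ[𝓝 s] fun _ => 1 := by
        filter_upwards [Ioi_mem_nhds hs] with y hy
          using Real.smoothTransition.one_of_one_le (le_of_lt hy)
      rw [this.deriv_eq, deriv_const]
  obtain ⟨M, hM⟩ := hc.bounded_above_of_compact_support hs
  exact ⟨M, hM⟩

lemma hasDerivAt_exp_neg_half (s : ℝ) :
    HasDerivAt (fun s : ℝ => Real.exp (-(s / 2))) (-(1 / 2) * Real.exp (-(s / 2))) s := by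
  have h := ((hasDerivAt_id s).div_const 2).neg.exp
  convert! h using 1
  simp
  ring

/-- The error lives on `s ≥ k`, where `e^{-s/2} ≤ e^{-s/4} e^{-k/4}`: one factor keeps
integrability, the other tends to zero. The derivative is treated in the same way. -/
lemma abs_cutoffExp_sub_le {k s : ℝ} (hk : 1 ≤ k) :
    |cutoffExp k s - Real.exp (-(s / 2))| ≤ Real.exp (-(s / 4)) * Real.exp (-(k / 4)) := by
  rcases lt_or_ge s k with hs | hs
  · have : cutoffExp k s = Real.exp (-(s / 2)) := by
      rw [cutoffExp, Real.smoothTransition.one_of_one_le, one_mul]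
      have : s / k < 1 := (div_lt_one (by linarith)).2 hs
      linarith
    rw [this, sub_self, abs_zero]
    positivity
  · have h1 : cutoffExp k s - Real.exp (-(s / 2)) =
        -((1 - Real.smoothTransition (2 - s / k)) * Real.exp (-(s / 2))) := by
      rw [cutoffExp]; ring
    have h2 := Real.smoothTransition.nonneg (2 - s / k)
    have h3 := Real.smoothTransition.le_one (2 - s / k)
    rw [h1, abs_neg, abs_mul, Real.abs_exp, abs_of_nonneg (by linarith), ← Real.exp_add]
    calc (1 - Real.smoothTransition (2 - s / k)) * Real.exp (-(s / 2))
        ≤ 1 * Real.exp (-(s / 4) + -(k / 4)) := by gcongr <;> linarith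
      _ = _ := one_mul _

lemma abs_deriv_cutoffExp_sub_le {M : ℝ} (hM : ∀ s, |deriv Real.smoothTransition s| ≤ M) {k s : ℝ}
    (hk : 1 ≤ k) : |deriv (cutoffExp k) s - -(1 / 2) * Real.exp (-(s / 2))| ≤
      (M + 1) * (Real.exp (-(s / 4)) * Real.exp (-(k / 4))) := by
  have hM0 : 0 ≤ M := (abs_nonneg _).trans (hM 0)
  rcases lt_or_ge s k with hs | hs
  · have : cutoffExp k =ᶠ[𝓝 s] fun s => Real.exp (-(s / 2)) := by
      filter_upwards [Iio_mem_nhds hs] with y hy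
      rw [cutoffExp, Real.smoothTransition.one_of_one_le, one_mul]
      have : y / k < 1 := (div_lt_one (by linarith)).2 hy
      linarith
    rw [this.deriv_eq, (hasDerivAt_exp_neg_half s).deriv, sub_self, abs_zero]
    positivity
  · have h0 : HasDerivAt (fun s => Real.smoothTransition (2 - s / k))
        (deriv Real.smoothTransition (2 - s / k) * -(1 / k)) s := by
      have h1 := ((Real.smoothTransition.contDiff (n := 1)).differentiable
        (by norm_num)).differentiableAt (x := 2 - s / k) |>.hasDerivAt
      exact h1.comp s (((hasDerivAt_id s).div_const k).const_sub 2)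
    have h1 : deriv (cutoffExp k) s = deriv Real.smoothTransition (2 - s / k) * -(1 / k) *
        Real.exp (-(s / 2)) + Real.smoothTransition (2 - s / k) *
          (-(1 / 2) * Real.exp (-(s / 2))) := (h0.mul (hasDerivAt_exp_neg_half s)).deriv
    have h2 := Real.smoothTransition.nonneg (2 - s / k)
    have h3 := Real.smoothTransition.le_one (2 - s / k)
    have h4 : deriv (cutoffExp k) s - -(1 / 2) * Real.exp (-(s / 2)) =
        (deriv Real.smoothTransition (2 - s / k) * -(1 / k) +
          1 / 2 * (1 - Real.smoothTransition (2 - s / k))) * Real.exp (-(s / 2)) := by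
      rw [h1]; ring
    have h5 : |deriv Real.smoothTransition (2 - s / k) * -(1 / k) +
          1 / 2 * (1 - Real.smoothTransition (2 - s / k))| ≤ M + 1 := by
      refine (abs_add_le _ _).trans (add_le_add ?_ ?_)
      · rw [abs_mul, abs_neg, abs_of_pos (by positivity : 0 < 1 / k)]
        calc _ ≤ M * 1 := mul_le_mul (hM _) ((div_le_one (by linarith)).2 hk) (by positivity) hM0
          _ = M := mul_one M
      · rw [abs_of_nonneg (by nlinarith)]; linarith
    rw [h4, abs_mul, Real.abs_exp, ← Real.exp_add]
    gcongr
    linarith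

/-- The cone contains a whole line in direction `e_i`, so a linear functional bounded above on it
must vanish on `e_i`. -/
lemma IsOuterNormal.inner_single_eq_zero {i : Fin n} (hi : IndependentOf w i)
    (hne : (supp w).Nonempty) {x η : Rn n} (hη : IsOuterNormal (supp w) x η) :
    inner ℝ (EuclideanSpace.single i (1 : ℝ)) η = 0 := by
  obtain ⟨y, hy⟩ := hne
  rw [real_inner_comm]
  by_contra hne
  set a := inner ℝ η (EuclideanSpace.single i (1 : ℝ))
  have hmem : ∀ t : ℝ, y + t • EuclideanSpace.single i (1 : ℝ) ∈ supp w := fun t => by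
    change 0 < w _
    rw [hi]; exact hy
  -- At this point of the line the inner product with `η` equals `1`, against the bound `≤ 0`.
  have h1 := hη _ (hmem ((1 - inner ℝ η (y - x)) / a))
  rw [add_sub_right_comm, inner_add_right, inner_smul_right] at h1
  change _ + _ / a * a ≤ 0 at h1
  rw [div_mul_cancel₀ _ hne] at h1
  linarith

/-- Both `2x` and `x/2` lie in the closed cone, so the normal inequality at `x` holds with both
signs. -/
lemma IsHomogeneousWeight.inner_eq_zero_of_isOuterNormal (hw : IsHomogeneousWeight w α)
    {x η : Rn n} (hx : x ∈ frontier (supp w)) (hη : IsOuterNormal (supp w) x η) :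
    inner ℝ x η = 0 := by
  have hcl : ∀ y ∈ closure (supp w), inner ℝ η (y - x) ≤ 0 := by
    have hclosed : IsClosed {y : Rn n | inner ℝ η (y - x) ≤ 0} :=
      isClosed_le (by fun_prop) continuous_const
    exact closure_minimal hη hclosed
  have hsm : ∀ t : ℝ, 0 < t → t • x ∈ closure (supp w) := fun t ht =>
    map_mem_closure (continuous_const_smul t) (frontier_subset_closure hx)
      fun y hy => hw.smul_mem ht hy
  have h1 := hcl _ (hsm 2 (by norm_num))
  have h2 := hcl _ (hsm (1 / 2) (by norm_num))
  rw [inner_sub_right, inner_smul_right] at h1 h2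
  rw [real_inner_comm]
  linarith

/-- The gradient is a combination of `e_i` and `x`, and both are orthogonal to every outer normal at
`x`; this is the Neumann condition. -/
lemma IsHomogeneousWeight.apply_mul_comp_norm_sq_mem_testClass (hw : IsHomogeneousWeight w α)
    {i : Fin n} (hi : IndependentOf w i) {ψ : ℝ → ℝ} (hψ : ContDiff ℝ ∞ ψ) {R : ℝ}
    (hR : ∀ s, R < s → ψ s = 0) : (fun x : Rn n => x i * ψ (‖x‖ ^ 2)) ∈ TestClass w := by
  refine ⟨?_, ?_, fun x hx η hη => ?_⟩
  · exact (EuclideanSpace.proj i : Rn n →L[ℝ] ℝ).contDiff.mul (hψ.comp (contDiff_norm_sq ℝ))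
  · refine HasCompactSupport.intro (isCompact_closedBall (0 : Rn n) √R) fun x hx => ?_
    rw [mem_closedBall_zero_iff, not_le] at hx
    rw [hR _ (Real.lt_sq_of_sqrt_lt hx), mul_zero]
  · rw [gradient_apply_mul_comp_norm_sq i ((hψ.differentiable (by simp)) _).hasDerivAt,
      inner_add_left, inner_smul_left, inner_smul_left, hη.inner_single_eq_zero hi hw.nonempty,
      hw.inner_eq_zero_of_isOuterNormal hx hη]
    simp

lemma hermite_eq (i : Fin n) :
    hermite i = fun x : Rn n => x i * (fun s => Real.exp (-(s / 2))) (‖x‖ ^ 2) := rfl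

lemma gradient_hermite (i : Fin n) (x : Rn n) : gradient (hermite i) x =
    Real.exp (-(‖x‖ ^ 2 / 2)) • (EuclideanSpace.single i (1 : ℝ) - x i • x) := by
  rw [hermite_eq, gradient_apply_mul_comp_norm_sq i (hasDerivAt_exp_neg_half _)]
  module

lemma continuous_apply_Rn (i : Fin n) : Continuous fun x : Rn n => x i :=
  (EuclideanSpace.proj i : Rn n →L[ℝ] ℝ).continuous

lemma continuous_hermite (i : Fin n) : Continuous (hermite i) := by
  have := continuous_apply_Rn i
  unfold hermite
  fun_prop

lemma continuous_gradient_hermite (i : Fin n) : Continuous (gradient (hermite i)) := by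
  have := continuous_apply_Rn i
  have h : gradient (hermite i) = fun x => Real.exp (-(‖x‖ ^ 2 / 2)) •
      (EuclideanSpace.single i (1 : ℝ) - x i • x) := funext (gradient_hermite i)
  rw [h]
  fun_prop

lemma norm_smul_single_add_le (i : Fin n) (x : Rn n) {a b r : ℝ} (ha : |a| ≤ r) {M : ℝ}
    (hM : 0 ≤ M) (hb : |b| ≤ M * r) :
    ‖a • EuclideanSpace.single i (1 : ℝ) + (2 * x i * b) • x‖ ≤
      (2 * M + 1) * ((1 + ‖x‖ ^ 2) ^ 1 * r) := by
  have hr : 0 ≤ r := (abs_nonneg a).trans ha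
  refine (norm_add_le _ _).trans ?_
  rw [norm_smul, norm_smul, PiLp.norm_single, norm_one, mul_one, Real.norm_eq_abs,
    Real.norm_eq_abs, abs_mul, abs_mul, abs_two]
  calc |a| + 2 * |x i| * |b| * ‖x‖ ≤ r + 2 * ‖x‖ * (M * r) * ‖x‖ := by
        gcongr; exact abs_apply_le_norm x i
    _ ≤ _ := by
        have h1 : 0 ≤ M * r := by positivity
        have h2 : 0 ≤ ‖x‖ ^ 2 * r := by positivity
        nlinarith

lemma norm_mul_apply_mul_le (i : Fin n) (x : Rn n) {a r : ℝ} (ha : |a| ≤ r) :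
    ‖‖x‖ * (x i * a)‖ ≤ (1 + ‖x‖ ^ 2) ^ 1 * r := by
  rw [norm_mul, norm_norm, norm_mul, Real.norm_eq_abs, Real.norm_eq_abs]
  calc ‖x‖ * (|x i| * |a|) ≤ ‖x‖ * (‖x‖ * r) := by gcongr; exact abs_apply_le_norm x i
    _ ≤ _ := by
      have hr : 0 ≤ r := (abs_nonneg a).trans ha
      nlinarith

lemma IsHomogeneousWeight.memS_hermite (hw : IsHomogeneousWeight w α) (h : HessianBound w 0)
    {i : Fin n} (hi : IndependentOf w i) : MemS w (hermite i) (gradient (hermite i)) := by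
  -- The rate `1/4` is what remains of `e^{-|x|²/2}` after `e^{-k/4}` has been split off from the
  -- cutoff error.
  obtain ⟨C, hC0, hC⟩ := exists_pow_mul_exp_le (n := n) 1 (b := 1 / 4) (by norm_num)
  have hch := continuous_hermite i
  have hcg := continuous_gradient_hermite i
  have hexp : ∀ x : Rn n, |Real.exp (-(‖x‖ ^ 2 / 2))| ≤ Real.exp (-(1 / 4 * ‖x‖ ^ 2)) := fun x => by
    rw [Real.abs_exp]
    apply Real.exp_le_exp.2
    nlinarith [sq_nonneg ‖x‖]
  have hψ' : ∀ x : Rn n, |-(1 / 2) * Real.exp (-(‖x‖ ^ 2 / 2))| ≤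
      1 * Real.exp (-(1 / 4 * ‖x‖ ^ 2)) := fun x => by
    rw [abs_mul]
    exact mul_le_mul (by norm_num [abs_of_pos]) (hexp x) (abs_nonneg _) (by norm_num)
  refine ⟨?_, ?_, fun ε hε => ?_⟩
  · refine hw.memLp_of_le_exp h (by fun_prop) (b := 1 / 4) (c := C) (by norm_num) fun x => ?_
    exact (norm_mul_apply_mul_le i x (hexp x)).trans (hC x)
  · refine hw.memLp_of_le_exp h hcg (b := 1 / 4) (c := 3 * C) (by norm_num) fun x => ?_
    rw [hermite_eq, gradient_apply_mul_comp_norm_sq i (hasDerivAt_exp_neg_half _)]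
    have h1 := norm_smul_single_add_le i x (hexp x) zero_le_one (hψ' x)
    have h2 := hC x
    linarith
  · obtain ⟨M, hM⟩ := exists_deriv_smoothTransition_le
    have hM0 : 0 ≤ M := (abs_nonneg _).trans (hM 0)
    set G : Rn n → ℝ := fun x => C * Real.exp (-((1 / 4) / 2 * ‖x‖ ^ 2))
    have hG : MemLp G 2 (wMeasure w) := hw.memLp_gaussian h C (by norm_num)
    set u : ℕ → Rn n → ℝ := fun k x => x i * cutoffExp k (‖x‖ ^ 2)
    have huA : ∀ k : ℕ, 1 ≤ k → u k ∈ TestClass w := fun k hk => by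
      refine hw.apply_mul_comp_norm_sq_mem_testClass hi (contDiff_cutoffExp k) (R := 2 * k)
        fun s hs => ?_
      rw [cutoffExp, Real.smoothTransition.zero_of_nonpos, zero_mul]
      have hk0 : (0 : ℝ) < k := by exact_mod_cast hk
      rw [sub_nonpos, le_div_iff₀ hk0]
      exact hs.le
    have hb1 : ∀ k : ℕ, 1 ≤ k → eLpNorm (fun x => gradient (u k) x - gradient (hermite i) x) 2
        (wMeasure w) ≤ ENNReal.ofReal ((2 * (M + 1) + 1) * Real.exp (-(k / 4))) *
          eLpNorm G 2 (wMeasure w) := fun k hk => by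
      have hk1 : (1 : ℝ) ≤ k := by exact_mod_cast hk
      refine eLpNorm_le_mul_eLpNorm_of_ae_le_mul (Eventually.of_forall fun x => ?_) 2
      rw [gradient_apply_mul_comp_norm_sq i
        ((contDiff_cutoffExp k).differentiable (by simp) _).hasDerivAt, hermite_eq,
        gradient_apply_mul_comp_norm_sq i (hasDerivAt_exp_neg_half _)]
      have h1 := norm_smul_single_add_le i x (abs_cutoffExp_sub_le (s := ‖x‖ ^ 2) hk1)
        (by linarith : 0 ≤ M + 1) (abs_deriv_cutoffExp_sub_le hM (s := ‖x‖ ^ 2) hk1)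
      have h2 := hC x
      have h3 : G x ≤ ‖G x‖ := le_abs_self _
      have h4 : Real.exp (-(‖x‖ ^ 2 / 4)) = Real.exp (-(1 / 4 * ‖x‖ ^ 2)) := by congr 1; ring
      rw [h4] at h1
      refine le_trans (le_of_eq ?_) (h1.trans ?_)
      · congr 1; module
      · calc _ = (2 * (M + 1) + 1) * Real.exp (-(k / 4)) *
              ((1 + ‖x‖ ^ 2) ^ 1 * Real.exp (-(1 / 4 * ‖x‖ ^ 2))) := by ring
          _ ≤ _ := by gcongr; exact h2.trans h3
    have hb2 : ∀ k : ℕ, 1 ≤ k → eLpNorm (fun x => ‖x‖ * (u k x - hermite i x)) 2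
        (wMeasure w) ≤ ENNReal.ofReal (Real.exp (-(k / 4))) *
          eLpNorm G 2 (wMeasure w) := fun k hk => by
      have hk1 : (1 : ℝ) ≤ k := by exact_mod_cast hk
      refine eLpNorm_le_mul_eLpNorm_of_ae_le_mul (Eventually.of_forall fun x => ?_) 2
      have h1 := norm_mul_apply_mul_le i x (abs_cutoffExp_sub_le (s := ‖x‖ ^ 2) hk1)
      have h2 := hC x
      have h3 : G x ≤ ‖G x‖ := le_abs_self _
      have h4 : Real.exp (-(‖x‖ ^ 2 / 4)) = Real.exp (-(1 / 4 * ‖x‖ ^ 2)) := by congr 1; ring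
      rw [h4] at h1
      refine le_trans (le_of_eq ?_) (h1.trans ?_)
      · simp only [u, hermite, mul_sub]
      · calc _ = Real.exp (-(k / 4)) *
              ((1 + ‖x‖ ^ 2) ^ 1 * Real.exp (-(1 / 4 * ‖x‖ ^ 2))) := by ring
          _ ≤ _ := by gcongr; exact h2.trans h3
    have he : Tendsto (fun k : ℕ => Real.exp (-((k : ℝ) / 4))) atTop (𝓝 0) :=
      Real.tendsto_exp_neg_atTop_nhds_zero.comp
        (tendsto_natCast_atTop_atTop.atTop_div_const (by norm_num))
    have hlim : Tendsto (fun k : ℕ => ENNReal.ofReal ((2 * (M + 1) + 1) * Real.exp (-(k / 4))) *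
        eLpNorm G 2 (wMeasure w) + ENNReal.ofReal (Real.exp (-(k / 4))) *
          eLpNorm G 2 (wMeasure w)) atTop (𝓝 0) := by
      have l1 := ENNReal.Tendsto.mul_const (ENNReal.tendsto_ofReal (he.const_mul (2 * (M + 1) + 1)))
        (b := eLpNorm G 2 (wMeasure w)) (Or.inr hG.2.ne)
      have l2 := ENNReal.Tendsto.mul_const (ENNReal.tendsto_ofReal he)
        (b := eLpNorm G 2 (wMeasure w)) (Or.inr hG.2.ne)
      simpa using l1.add l2
    obtain ⟨k, hk, hk1⟩ := ((hlim.eventually_lt_const hε).and (eventually_ge_atTop 1)).exists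
    exact ⟨u k, huA k hk1, (add_le_add (hb1 k hk1) (hb2 k hk1)).trans_lt hk⟩

/-- The set where two continuous functions differ inside the open cone is open, so it is empty if
null. -/
lemma IsHomogeneousWeight.eqOn_of_ae_eq (hw : IsHomogeneousWeight w α) {f h : Rn n → ℝ}
    (hf : Continuous f) (hh : Continuous h) (hfh : f =ᵐ[wMeasure w] h) :
    Set.EqOn f h (supp w) := by
  have hopen : IsOpen (supp w ∩ {x | f x ≠ h x}) := hw.isOpen.inter (isOpen_ne_fun hf hh)
  have h0 : wMeasure w {x | f x ≠ h x} = 0 := hfh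
  have h1 := (withDensity_apply_eq_zero (μ := (volume : Measure (Rn n)))
    (f := fun x => ENNReal.ofReal (w x)) (by have := hw.measurable; fun_prop)).1 h0
  have h2 : {x | ENNReal.ofReal (w x) ≠ 0} = supp w := by
    ext x
    simp [supp]
  rw [h2] at h1
  have h3 := hopen.measure_eq_zero_iff volume |>.1 h1
  intro x hx
  by_contra hne
  have : x ∈ supp w ∩ {x | f x ≠ h x} := ⟨hx, hne⟩
  rw [h3] at this
  exact this

lemma IsHomogeneousWeight.hermite_not_ae_eq_gaussian (hw : IsHomogeneousWeight w α) {i : Fin n}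
    (hi : IndependentOf w i) {h : Rn n → ℝ} (hh : h ∈ gaussians n) :
    ¬ hermite i =ᵐ[wMeasure w] h := by
  obtain ⟨c, β, -, rfl⟩ := hh
  intro hae
  have heq := hw.eqOn_of_ae_eq (continuous_hermite i) (by fun_prop) hae
  obtain ⟨x, hx⟩ := hw.nonempty
  have hmem : ∀ t : ℝ, x + t • EuclideanSpace.single i (1 : ℝ) ∈ supp w := fun t => by
    change 0 < w _
    rw [hi]; exact hx
  -- On the line through `x` in direction `e_i`, the coordinate `x_i` takes the value `0`, which
  -- forces `c = 0`, and the value `1`, where the function is nonzero.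
  have h1 := heq (hmem (-x i))
  have h2 := heq (hmem (1 - x i))
  have hc : c = 0 := by
    simp only [hermite, PiLp.add_apply, PiLp.smul_apply, PiLp.single_apply, if_true,
      smul_eq_mul, mul_one, add_neg_cancel, zero_mul] at h1
    exact (mul_eq_zero.1 h1.symm).resolve_right (Real.exp_ne_zero _)
  simp only [hermite, PiLp.add_apply, PiLp.smul_apply, PiLp.single_apply, if_true,
    smul_eq_mul, mul_one, add_sub_cancel, one_mul, hc, zero_mul] at h2
  exact Real.exp_ne_zero _ h2

/-! ### Integration by parts, moments, and equality. -/

/-- Integration by parts in a direction in which the weight is constant. -/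
lemma IsHomogeneousWeight.integral_fderiv_single_eq_zero (hw : IsHomogeneousWeight w α) {i : Fin n}
    (hi : IndependentOf w i) {φ : Rn n → ℝ} (hφ : Differentiable ℝ φ)
    (h1 : Integrable φ (wMeasure w))
    (h2 : Integrable (fun x => fderiv ℝ φ x (EuclideanSpace.single i 1)) (wMeasure w)) :
    ∫ x, fderiv ℝ φ x (EuclideanSpace.single i 1) ∂wMeasure w = 0 := by
  rw [integrable_wMeasure_iff hw.measurable hw.nonneg] at h1 h2
  have hline : ∀ x, HasLineDerivAt ℝ w 0 x (EuclideanSpace.single i 1) := fun x => by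
    unfold HasLineDerivAt
    simp only [hi x]
    exact hasDerivAt_const _ _
  have key := integral_bilinear_hasLineDerivAt_right_eq_neg_left_of_integrable
    (μ := (volume : Measure (Rn n))) (f := φ) (g := w) (g' := fun _ => 0)
    (v := EuclideanSpace.single i 1) (B := ContinuousLinearMap.mul ℝ ℝ)
    (f' := fun x => fderiv ℝ φ x (EuclideanSpace.single i 1))
    (by simpa only [ContinuousLinearMap.mul_apply', mul_comm] using h2) (by simp)
    (by simpa only [ContinuousLinearMap.mul_apply', mul_comm] using h1)
    (fun x _ => (hφ x).hasFDerivAt.hasLineDerivAt _) (fun x _ => hline x)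
  rw [integral_wMeasure hw.measurable hw.nonneg]
  simp only [ContinuousLinearMap.mul_apply', mul_zero, integral_zero] at key
  simp only [mul_comm (w _)]
  linarith

lemma fderiv_exp_single (i : Fin n) (b : ℝ) (x : Rn n) :
    fderiv ℝ (fun x : Rn n => Real.exp (-(b * ‖x‖ ^ 2))) x (EuclideanSpace.single i 1) =
      -(2 * b) * (x i * Real.exp (-(b * ‖x‖ ^ 2))) := by
  have h := hasFDerivAt_exp_mul_norm_sq (-b) x
  simp only [neg_mul] at h
  rw [h.fderiv]
  simp [EuclideanSpace.inner_single_right]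
  ring

/-- Up to a constant the integrand is `∂_i e^{-b|x|²}`. This is the orthogonality of `x_i
e^{-|x|²/2}` to all centred Gaussians. -/
lemma IsHomogeneousWeight.integral_apply_mul_exp (hw : IsHomogeneousWeight w α)
    (h : HessianBound w 0) {i : Fin n} (hi : IndependentOf w i) {b : ℝ} (hb : 0 < b) :
    ∫ x, x i * Real.exp (-(b * ‖x‖ ^ 2)) ∂wMeasure w = 0 := by
  have hci := continuous_apply_Rn i
  have i1 : Integrable (fun x => x i * Real.exp (-(b * ‖x‖ ^ 2))) (wMeasure w) := by
    refine hw.integrable_of_le_pow_mul_exp h (by fun_prop) 1 hb (c := 1) fun x => ?_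
    rw [norm_mul, Real.norm_of_nonneg (Real.exp_nonneg _), one_mul, pow_one, Real.norm_eq_abs]
    gcongr
    nlinarith [abs_apply_le_norm x i, sq_nonneg (‖x‖ - 1), sq_nonneg ‖x‖]
  have key := hw.integral_fderiv_single_eq_zero hi
    (φ := fun x : Rn n => Real.exp (-(b * ‖x‖ ^ 2)))
    (fun x => by
      have := (hasFDerivAt_exp_mul_norm_sq (-b) x).differentiableAt
      simpa only [neg_mul] using this)
    (hw.integrable_exp h hb) (by simpa only [fderiv_exp_single] using i1.const_mul _)
  simp only [fderiv_exp_single, integral_const_mul] at key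
  exact (mul_eq_zero.1 key).resolve_left (by simp [hb.ne'])

lemma hermite_sq (i : Fin n) (x : Rn n) :
    hermite i x ^ 2 = x i ^ 2 * Real.exp (-(1 * ‖x‖ ^ 2)) := by
  rw [hermite, mul_pow, ← Real.exp_nat_mul]
  congr 2
  push_cast
  ring

lemma IsHomogeneousWeight.integrable_hermite_sq (hw : IsHomogeneousWeight w α)
    (h : HessianBound w 0) (i : Fin n) :
    Integrable (fun x => hermite i x ^ 2) (wMeasure w) := by
  have hch := continuous_hermite i
  refine hw.integrable_of_le_pow_mul_exp h (by fun_prop) 1 one_pos (c := 1) fun x => ?_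
  rw [Real.norm_of_nonneg (sq_nonneg _), hermite_sq, pow_one, one_mul (_ * _)]
  refine mul_le_mul_of_nonneg_right ?_ (Real.exp_nonneg _)
  linarith [sq_apply_le_norm_sq x i]

lemma norm_norm_sq_mul_hermite_sq_le (i : Fin n) (x : Rn n) : ‖‖x‖ ^ 2 * hermite i x ^ 2‖ ≤
    1 * ((1 + ‖x‖ ^ 2) ^ 2 * Real.exp (-(1 * ‖x‖ ^ 2))) := by
  rw [Real.norm_of_nonneg (by positivity), hermite_sq, one_mul (_ * _), ← mul_assoc]
  refine mul_le_mul_of_nonneg_right ?_ (Real.exp_nonneg _)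
  nlinarith [sq_apply_le_norm_sq x i, sq_nonneg (x i), sq_nonneg ‖x‖]

lemma IsHomogeneousWeight.integrable_norm_sq_mul_hermite_sq (hw : IsHomogeneousWeight w α)
    (h : HessianBound w 0) (i : Fin n) :
    Integrable (fun x => ‖x‖ ^ 2 * hermite i x ^ 2) (wMeasure w) := by
  have hch := continuous_hermite i
  exact hw.integrable_of_le_pow_mul_exp h (by fun_prop) 2 one_pos (norm_norm_sq_mul_hermite_sq_le i)

/-- Integration by parts applied to `∂_i (x_i e^{-|x|²})`. -/
lemma IsHomogeneousWeight.integral_exp_eq (hw : IsHomogeneousWeight w α)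
    (h : HessianBound w 0) {i : Fin n} (hi : IndependentOf w i) :
    ∫ x, Real.exp (-(1 * ‖x‖ ^ 2)) ∂wMeasure w = 2 * ∫ x, hermite i x ^ 2 ∂wMeasure w := by
  have hci := continuous_apply_Rn i
  have hd : ∀ x : Rn n, HasFDerivAt (fun x : Rn n => x i * Real.exp (-1 * ‖x‖ ^ 2)) _ x := fun x =>
    (hasFDerivAt_apply i x).fun_mul (hasFDerivAt_exp_mul_norm_sq (-1) x)
  have hf : ∀ x : Rn n, fderiv ℝ (fun x : Rn n => x i * Real.exp (-1 * ‖x‖ ^ 2)) x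
      (EuclideanSpace.single i 1) = Real.exp (-(1 * ‖x‖ ^ 2)) - 2 * hermite i x ^ 2 := fun x => by
    rw [(hd x).fderiv, hermite_sq]
    simp [EuclideanSpace.inner_single_right]
    ring
  have i1 := hw.integrable_exp h one_pos
  have i2 := (hw.integrable_hermite_sq h i).const_mul 2
  have i3 : Integrable (fun x => x i * Real.exp (-1 * ‖x‖ ^ 2)) (wMeasure w) := by
    refine hw.integrable_of_le_pow_mul_exp h (by fun_prop) 1 one_pos (c := 1) fun x => ?_
    rw [norm_mul, Real.norm_of_nonneg (Real.exp_nonneg _), one_mul, pow_one, Real.norm_eq_abs,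
      neg_mul]
    gcongr
    nlinarith [abs_apply_le_norm x i, sq_nonneg (‖x‖ - 1), sq_nonneg ‖x‖]
  have key := hw.integral_fderiv_single_eq_zero hi (fun x => (hd x).differentiableAt) i3
    (by simp only [hf]; exact i1.sub i2)
  simp only [hf] at key
  rw [integral_sub i1 i2, integral_const_mul] at key
  linarith

/-- Euler's identity for `h²`, whose radial derivative is `2h² - 2|x|²h²`. -/
lemma IsHomogeneousWeight.integral_norm_sq_mul_hermite_sq (hw : IsHomogeneousWeight w α)
    (h : HessianBound w 0) (i : Fin n) :
    ∫ x, ‖x‖ ^ 2 * hermite i x ^ 2 ∂wMeasure w =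
      ((n : ℝ) + α + 2) / 2 * ∫ x, hermite i x ^ 2 ∂wMeasure w := by
  have hcd : ContDiff ℝ 1 fun x => hermite i x ^ 2 := by
    refine ContDiff.pow ?_ 2
    exact (EuclideanSpace.proj i : Rn n →L[ℝ] ℝ).contDiff.mul
      (Real.contDiff_exp.comp ((contDiff_norm_sq ℝ).div_const 2).neg)
  have hdiff : ∀ x : Rn n, DifferentiableAt ℝ (hermite i) x := fun x =>
    ((hasFDerivAt_apply i x).fun_mul
      (hasFDerivAt_comp_norm_sq (hasDerivAt_exp_neg_half (‖x‖ ^ 2)))).differentiableAt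
  have hf : ∀ x : Rn n, fderiv ℝ (fun x => hermite i x ^ 2) x x =
      2 * hermite i x ^ 2 - 2 * (‖x‖ ^ 2 * hermite i x ^ 2) := fun x => by
    rw [((hdiff x).hasFDerivAt.pow 2).fderiv]
    simp only [Nat.add_one_sub_one, pow_one, nsmul_eq_mul, Nat.cast_ofNat, smul_apply, smul_eq_mul]
    rw [← inner_gradient, gradient_hermite, inner_smul_left, inner_sub_left, inner_smul_left,
      EuclideanSpace.inner_single_left, real_inner_self_eq_norm_sq, hermite]
    simp
    ring
  obtain ⟨C, hC0, hC⟩ := exists_pow_mul_exp_le (n := n) 2 (b := 1) one_pos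
  have hb0 : ∀ x : Rn n, ‖hermite i x ^ 2‖ ≤ 4 * C * Real.exp (-(1 / 2 * ‖x‖ ^ 2)) := fun x => by
    rw [hermite_sq, Real.norm_of_nonneg (by positivity)]
    have h1 := hC x
    have h2 : x i ^ 2 * Real.exp (-(1 * ‖x‖ ^ 2)) ≤
        (1 + ‖x‖ ^ 2) ^ 2 * Real.exp (-(1 * ‖x‖ ^ 2)) := by
      refine mul_le_mul_of_nonneg_right ?_ (Real.exp_nonneg _)
      nlinarith [sq_apply_le_norm_sq x i, sq_nonneg (‖x‖ ^ 2), sq_nonneg ‖x‖]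
    have h3 : 0 ≤ C * Real.exp (-(1 / 2 * ‖x‖ ^ 2)) := by positivity
    linarith
  have hb1 : ∀ x : Rn n, ‖fderiv ℝ (fun x => hermite i x ^ 2) x x‖ ≤
      4 * C * Real.exp (-(1 / 2 * ‖x‖ ^ 2)) := fun x => by
    rw [hf]
    have h1 := hC x
    have h2 := norm_norm_sq_mul_hermite_sq_le i x
    have h3 : ‖hermite i x ^ 2‖ ≤ (1 + ‖x‖ ^ 2) ^ 2 * Real.exp (-(1 * ‖x‖ ^ 2)) := by
      rw [hermite_sq, Real.norm_of_nonneg (by positivity)]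
      refine mul_le_mul_of_nonneg_right ?_ (Real.exp_nonneg _)
      nlinarith [sq_apply_le_norm_sq x i, sq_nonneg (‖x‖ ^ 2), sq_nonneg ‖x‖]
    refine (norm_sub_le _ _).trans ?_
    rw [norm_mul 2, norm_mul 2, Real.norm_of_nonneg (zero_le_two (α := ℝ))]
    linarith
  have key := hw.integral_fderiv_self h hcd (c := 1 / 2) (by norm_num) hb0 hb1
  simp only [hf] at key
  rw [integral_sub ((hw.integrable_hermite_sq h i).const_mul 2)
    ((hw.integrable_norm_sq_mul_hermite_sq h i).const_mul 2), integral_const_mul,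
    integral_const_mul] at key
  linarith

lemma norm_gradient_hermite_sq (i : Fin n) (x : Rn n) : ‖gradient (hermite i) x‖ ^ 2 =
    Real.exp (-(1 * ‖x‖ ^ 2)) - 2 * hermite i x ^ 2 + ‖x‖ ^ 2 * hermite i x ^ 2 := by
  have h1 : Real.exp (-(‖x‖ ^ 2 / 2)) ^ 2 = Real.exp (-(1 * ‖x‖ ^ 2)) := by
    rw [← Real.exp_nat_mul]; congr 1; push_cast; ring
  rw [gradient_hermite, norm_smul, mul_pow, Real.norm_eq_abs, sq_abs, h1, norm_sub_sq_real,
    inner_smul_right, EuclideanSpace.inner_single_left, norm_smul, mul_pow, Real.norm_eq_abs,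
    sq_abs, hermite_sq, PiLp.norm_single]
  simp
  ring

/-- The two norms in the product coincide, so the product is `∫|x|²h²w = ((n+α+2)/2)∫h²w`, which
exceeds the subtracted term by `∫h²w`. -/
lemma IsHomogeneousWeight.deficit_hermite (hw : IsHomogeneousWeight w α) (h : HessianBound w 0)
    {i : Fin n} (hi : IndependentOf w i) :
    deficit w α (hermite i) (gradient (hermite i)) = ∫ x, hermite i x ^ 2 ∂wMeasure w := by
  have i1 := hw.integrable_exp h one_pos
  have i2 := (hw.integrable_hermite_sq h i).const_mul 2
  have i3 := hw.integrable_norm_sq_mul_hermite_sq h i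
  have e1 : ∫ x, ‖gradient (hermite i) x‖ ^ 2 ∂wMeasure w =
      ∫ x, ‖x‖ ^ 2 * hermite i x ^ 2 ∂wMeasure w := by
    simp only [norm_gradient_hermite_sq]
    rw [integral_add (by fun_prop) i3, integral_sub i1 i2, integral_const_mul,
      hw.integral_exp_eq h hi]
    ring
  have e2 : ∀ x, |hermite i x| ^ 2 * ‖x‖ ^ 2 = ‖x‖ ^ 2 * hermite i x ^ 2 := fun x => by
    rw [sq_abs, mul_comm]
  simp only [deficit, e2, e1]
  simp only [sq_abs]
  rw [Real.mul_self_sqrt (integral_nonneg fun x => by positivity),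
    hw.integral_norm_sq_mul_hermite_sq h i]
  ring

/-- By orthogonality, Pythagoras shows that subtracting a Gaussian only increases the norm, so `c =
0` attains the infimum. -/
lemma IsHomogeneousWeight.gaussDist_hermite_sq (hw : IsHomogeneousWeight w α)
    (h : HessianBound w 0) {i : Fin n} (hi : IndependentOf w i) :
    gaussDist w (hermite i) ^ 2 = ∫ x, hermite i x ^ 2 ∂wMeasure w := by
  have hle : gaussDist w (hermite i) ≤ √(∫ x, hermite i x ^ 2 ∂wMeasure w) := by
    have := gaussDist_le (w := w) (hermite i) 0 one_pos
    simpa using this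
  have hge : √(∫ x, hermite i x ^ 2 ∂wMeasure w) ≤ gaussDist w (hermite i) := by
    have : Nonempty (ℝ × {l : ℝ // l ≠ 0}) := ⟨(0, ⟨1, one_ne_zero⟩)⟩
    refine le_ciInf fun ⟨c, l, hl⟩ => Real.sqrt_le_sqrt ?_
    have hl2 : 0 < l ^ 2 := by positivity
    set b := (l ^ 2)⁻¹
    have hb : 0 < b := inv_pos.2 hl2
    have hG := (hw.memLp_gaussian h c hb).integrable_sq
    have e1 : ∀ x : Rn n, |hermite i x - c * Real.exp (-(‖x‖ ^ 2 / (2 * l ^ 2)))| ^ 2 =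
        hermite i x ^ 2 - 2 * c * (x i * Real.exp (-((1 / 2 + b / 2) * ‖x‖ ^ 2))) +
          (c * Real.exp (-(b / 2 * ‖x‖ ^ 2))) ^ 2 := fun x => by
      have h1 : ‖x‖ ^ 2 / (2 * l ^ 2) = b / 2 * ‖x‖ ^ 2 := by simp only [b]; field_simp
      have h2 : Real.exp (-((1 / 2 + b / 2) * ‖x‖ ^ 2)) =
          Real.exp (-(‖x‖ ^ 2 / 2)) * Real.exp (-(b / 2 * ‖x‖ ^ 2)) := by
        rw [← Real.exp_add]; congr 1; ring
      rw [sq_abs, h1, h2, hermite]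
      ring
    have i2 : Integrable (fun x => 2 * c * (x i * Real.exp (-((1 / 2 + b / 2) * ‖x‖ ^ 2))))
        (wMeasure w) := by
      have hci := continuous_apply_Rn i
      refine Integrable.const_mul (hw.integrable_of_le_pow_mul_exp h (by fun_prop) 1
        (b := 1 / 2 + b / 2) (by positivity) (c := 1) fun x => ?_) _
      rw [norm_mul, Real.norm_of_nonneg (Real.exp_nonneg _), one_mul, pow_one, Real.norm_eq_abs]
      gcongr
      nlinarith [abs_apply_le_norm x i, sq_nonneg (‖x‖ - 1), sq_nonneg ‖x‖]
    simp only [e1]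
    have i1 := hw.integrable_hermite_sq h i
    rw [integral_add (by fun_prop) hG, integral_sub i1 i2, integral_const_mul,
      hw.integral_apply_mul_exp h hi (by positivity), mul_zero, sub_zero]
    exact le_add_of_nonneg_right (integral_nonneg fun x => sq_nonneg _)
  rw [le_antisymm hle hge, Real.sq_sqrt (integral_nonneg fun x => sq_nonneg _)]

end Hermite

end WeightedHeisenberg

end

theorem theorem1p6 (n : ℕ) (hn : 1 ≤ n) (α : ℝ) (hα : 0 ≤ α)
    (w : WeightedHeisenberg.Rn n → ℝ)
    (hw : WeightedHeisenberg.IsHomogeneousWeight w α) (hstar : WeightedHeisenberg.Star w) :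
    (∀ (f : WeightedHeisenberg.Rn n → ℝ)
        (g : WeightedHeisenberg.Rn n → WeightedHeisenberg.Rn n),
      WeightedHeisenberg.MemS w f g →
        MemLp f 2 (WeightedHeisenberg.wMeasure w) ∧
        WeightedHeisenberg.deficit w α f g ≥
          (1 + WeightedHeisenberg.curvature w) * WeightedHeisenberg.gaussDist w f ^ 2) ∧
    (∀ i : Fin n, WeightedHeisenberg.IndependentOf w i →
      WeightedHeisenberg.MemS w (WeightedHeisenberg.hermite i)
        (gradient (WeightedHeisenberg.hermite i)) ∧
      (∀ h ∈ WeightedHeisenberg.gaussians n,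
        ¬ WeightedHeisenberg.hermite i =ᵐ[WeightedHeisenberg.wMeasure w] h) ∧
      WeightedHeisenberg.deficit w α (WeightedHeisenberg.hermite i)
          (gradient (WeightedHeisenberg.hermite i)) =
        (1 + WeightedHeisenberg.curvature w) *
          WeightedHeisenberg.gaussDist w (WeightedHeisenberg.hermite i) ^ 2) := by
  have hN : 0 < (n : ℝ) + α := by
    have : (1 : ℝ) ≤ n := by exact_mod_cast hn
    linarith
  have h := hw.hessianBound_zero hstar
  rw [hw.curvature_eq_zero hstar hn, add_zero]
  simp only [one_mul]
  refine ⟨fun f g hf => ⟨(hw.exists_approx h hn hN hf).1, hw.gaussDist_sq_le_deficit h hn hN hf⟩,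
    fun i hi => ⟨hw.memS_hermite h hi, fun _ hh => hw.hermite_not_ae_eq_gaussian hi hh, ?_⟩⟩
  rw [hw.deficit_hermite h hi, hw.gaussDist_hermite_sq h hi]
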